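/- **Conventions.** Let $\mathbb H$ be an infinite-dimensional separable real Hilbert space (equivalently $\mathbb H=\ell^2$). All sets and measures are Borel, $\mathcal H^1$ is one-dimensional Hausdorff measure, $\mathcal G_1(\mathbb H)$ is the set of one-dimensional linear subspaces of $\mathbb H$ (with the Borel structure of the metric $\|\pi_V-\pi_W\|$), and $\pi_V$ is the orthogonal projection onto $V$. For $V,T\in\mathcal G_1(\mathbb H)$ let $\det(\pi_V|T)=\|\pi_V t\|$, where $t$ is a unit vector spanning $T$ (this is the metric determinant of $\pi_V|_T$). For a set $R\subset\mathbb H$, a $\sigma$-finite measure $\mu$ on $R$ and a Borel function $T:R\to\mathcal G_1(\mathbb H)$, we say that $(\mu,T)$ satisfies the projection formula on $R$ if for every $V\in\mathcal G_1(\mathbb H)$ and every $A\subset R$ $$\int_V \#\big(\pi_V^{-1}(y)\cap A\big)\,d\mathcal H^1(y)=\int_A\det\big(\pi_V|T(x)\big)\,d\mu(x).\qquad(\ast)$$ A set $R$ is *($1$-)pseudorectifiable* if $\mathcal H^1|_R$ is $\sigma$-finite and some pair $(\mu,T)$ satisfying the projection formula on $R$ has $\mu\ll\mathcal H^1|_R\ll\mu$.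 It is *($1$-)rectifiable* if there are countably many Lipschitz maps $f_i:[0,1]\to\mathbb H$ with $\mathcal H^1\big(R\setminus\bigcup_i f_i([0,1])\big)=0$. A *similarity IFS* is a finite family $(u_a)_{a\in E}$ of contracting (surjective) similarities of $\mathbb H$; its *limit set* is the set of all limits $\lim_n u_{\omega_1}\circ\cdots\circ u_{\omega_n}(p)$, $\omega\in E^{\mathbb N}$ (which do not depend on $p$); it satisfies the *strong separation condition* if the images of the limit set under the maps $u_a$, $a\in E$, are pairwise disjoint. **Statement.** There exist sets $R_1,R_2\subset\mathbb H$ and pairs $(\mu_1,T_1)$, $(\mu_2,T_2)$ such that: 1. For $i=1,2$ the pair $(\mu_i,T_i)$ satisfies the projection formula $(\ast)$ on $R_i$. 2. $\mu_1\ll\mathcal H^1|_{R_1}\ll\mu_1$, but $\mu_1\neq\mathcal H^1|_{R_1}$; moreover $R_1$ is pseudorectifiable but not rectifiable. 3. $\mathcal H^1(R_2)<\infty$, but $\mathcal H^1|_{R_2}$ is not absolutely continuous with respect to $\mu_2$; moreover $R_2$ is not pseudorectifiable. 4. Both $R_1$ and $R_2$ are limit sets of similarity IFSes satisfying the strong separation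 condition. 5. There is a bounded linear map $L:\mathbb H\to\mathbb H$ with $R_2=L[R_1]$. -/

import Mathlib

open MeasureTheory Set Filter Topology
open scoped ENNReal

noncomputable section

/-- `Grass k H` is the set of `k`-dimensional linear subspaces of `H`. -/
def Grass (k : ℕ) (H : Type*) [NormedAddCommGroup H] [InnerProductSpace ℝ H] : Type _ :=
  {V : Submodule ℝ H // FiniteDimensional ℝ V ∧ Module.finrank ℝ V = k}

/-- The subspace underlying a point of the Grassmannian. -/
def Grass.space {k : ℕ} {H : Type*} [NormedAddCommGroup H] [InnerProductSpace ℝ H]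
    (V : Grass k H) : Submodule ℝ H := V.1

instance Grass.instFiniteDimensional {k : ℕ} {H : Type*} [NormedAddCommGroup H]
    [InnerProductSpace ℝ H] (V : Grass k H) : FiniteDimensional ℝ V.space := V.2.1

/-- The Borel structure on `Grass k H`, for the metric `‖π_V - π_W‖` between the orthogonal
projections onto two subspaces. -/
instance Grass.instMeasurableSpace {k : ℕ} {H : Type*} [NormedAddCommGroup H]
    [InnerProductSpace ℝ H] : MeasurableSpace (Grass k H) :=
  (borel (H →L[ℝ] H)).comap fun V => V.space.starProjection

/-- The metric determinant of a linear map `L : E → F` whose domain is a finite-dimensional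
Euclidean space: the square root of the Gram determinant of the images of an orthonormal basis.
By `metricDet_eq_abs_det` it is `|det (φ ∘ L)|` for every linear isometry `φ : L(E) → E`. -/
def metricDet {E F : Type*} [NormedAddCommGroup E] [InnerProductSpace ℝ E]
    [FiniteDimensional ℝ E] [NormedAddCommGroup F] [InnerProductSpace ℝ F] (L : E →ₗ[ℝ] F) : ℝ :=
  Real.sqrt (Matrix.gram ℝ fun i => L (stdOrthonormalBasis ℝ E i)).det

theorem metricDet_eq_abs_det {E F : Type*} [NormedAddCommGroup E] [InnerProductSpace ℝ E]
    [FiniteDimensional ℝ E] [NormedAddCommGroup F] [InnerProductSpace ℝ F] (L : E →ₗ[ℝ] F)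
    (φ : L.range →ₗᵢ[ℝ] E) :
    metricDet L = |LinearMap.det (φ.toLinearMap ∘ₗ L.rangeRestrict)| := by
  set b := stdOrthonormalBasis ℝ E with hb
  set M := LinearMap.toMatrix b.toBasis b.toBasis (φ.toLinearMap ∘ₗ L.rangeRestrict) with hM
  have hgram : (Matrix.gram ℝ fun i => L (b i)) = M.transpose * M := by
    have h1 : (Matrix.gram ℝ fun i => L (b i)) =
        Matrix.gram ℝ fun i => φ (L.rangeRestrict (b i)) := by
      ext i j
      simp only [Matrix.gram_apply, LinearIsometry.inner_map_map]
      rfl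
    rw [h1, Matrix.gram_eq_conjTranspose_mul b]
    have h2 : (Matrix.of fun i j => b.repr (φ (L.rangeRestrict (b j))) i) = M := by
      ext i j
      simp [hM, LinearMap.toMatrix_apply]
    rw [Matrix.conjTranspose_eq_transpose_of_trivial, h2]
  rw [metricDet, ← hb, hgram, Matrix.det_mul, Matrix.det_transpose, Real.sqrt_mul_self_eq_abs,
    hM, LinearMap.det_toMatrix]

variable {H : Type*} [NormedAddCommGroup H] [InnerProductSpace ℝ H]

/-- `det (π_V | T)`: the metric determinant of the orthogonal projection onto `V`, restricted
to `T`. -/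
def projDet {k : ℕ} (V T : Grass k H) : ℝ :=
  metricDet (V.space.starProjection.toLinearMap ∘ₗ T.space.subtype)

/-- `μ` is a σ-finite Borel measure on `R` and `T : R → Grass k H` is a Borel function (only its
values on `R` matter) such that for every `k`-dimensional subspace `V` and every Borel set
`A ⊆ R`,
`∫ #(π_V⁻¹(y) ∩ A) dℋᵏ(y) = ∫_A det (π_V | T x) dμ(x)`, where `y` ranges over `V`. -/
structure SatisfiesProjectionFormula [MeasurableSpace H] [BorelSpace H] (k : ℕ) (R : Set H)
    (μ : Measure H) (T : H → Grass k H) : Prop where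
  sigmaFinite : SigmaFinite μ
  measure_compl : μ Rᶜ = 0
  measurable : Measurable T
  formula : ∀ (V : Grass k H) (A : Set H), MeasurableSet A → A ⊆ R →
    ∫⁻ y : V.space, ((V.space.orthogonalProjectionOnto ⁻¹' {y} ∩ A).encard : ℝ≥0∞) ∂μH[(k : ℝ)] =
      ∫⁻ x in A, ENNReal.ofReal (projDet V (T x)) ∂μ

/-- `k`-pseudorectifiability of a Borel set `R`. -/
def IsPseudorectifiable [MeasurableSpace H] [BorelSpace H] (k : ℕ) (R : Set H) : Prop :=
  MeasurableSet R ∧ SigmaFinite ((μH[(k : ℝ)] : Measure H).restrict R) ∧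
    ∃ (μ : Measure H) (T : H → Grass k H), SatisfiesProjectionFormula k R μ T ∧
      μ ≪ (μH[(k : ℝ)] : Measure H).restrict R ∧ (μH[(k : ℝ)] : Measure H).restrict R ≪ μ

/-- `k`-rectifiability: up to an `ℋᵏ`-null set, `R` is covered by countably many Lipschitz images
of the cube `[0,1]ᵏ`. -/
def IsRectifiable [MeasurableSpace H] [BorelSpace H] (k : ℕ) (R : Set H) : Prop :=
  ∃ f : ℕ → EuclideanSpace ℝ (Fin k) → H,
    (∀ i, ∃ K, LipschitzOnWith K (f i) {x | ∀ j, x j ∈ Icc (0 : ℝ) 1}) ∧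
      (μH[(k : ℝ)] : Measure H) (R \ ⋃ i, f i '' {x | ∀ j, x j ∈ Icc (0 : ℝ) 1}) = 0

/-- `ifsWord u ω n = u_{ω 0} ∘ ⋯ ∘ u_{ω (n - 1)}`. -/
def ifsWord {X E : Type*} (u : E → X → X) (ω : ℕ → E) : ℕ → X → X
  | 0 => id
  | n + 1 => ifsWord u ω n ∘ u (ω n)

/-- The limit set of an iterated function system: the image of the coding map
`ω ↦ lim_n u_{ω 0} ∘ ⋯ ∘ u_{ω (n - 1)} (p)`. For a system of uniform contractions of a complete
space this limit exists and does not depend on the base point `p`. -/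
def ifsLimitSet {X E : Type*} [TopologicalSpace X] (u : E → X → X) : Set X :=
  {x | ∃ ω : ℕ → E, ∀ p, Tendsto (fun n => ifsWord u ω n p) atTop (𝓝 x)}

/-- `R` is the limit set of a finite iterated function system consisting of contracting
(surjective) similarities of `X` and satisfying the strong separation condition: the images of
the limit set under the generators are pairwise disjoint. -/
def IsSeparatedSimilarityLimitSet {X : Type*} [MetricSpace X] (R : Set X) : Prop :=
  ∃ (m : ℕ) (u : Fin m → X ≃ᵈ X), (∀ a, Dilation.ratio (u a) < 1) ∧
    ifsLimitSet (fun a => ⇑(u a)) = R ∧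
    Pairwise fun a b => Disjoint (u a '' R) (u b '' R)

end

/-!
Fix a Hilbert basis of `H` consisting of a vector `e`, pairwise distinct vectors `g w` indexed by
the finite binary words `w`, and possibly further vectors, arranged so that for each digit `a` some
unitary operator `U a` fixes `e` and maps `g w` to `g (a :: w)`. The similarities
`x ↦ (U a x + [a = 1] (κ e + 4 g [])) / 2` have as limit set the points
`∑ₙ 2⁻ⁿ⁻¹ ωₙ (κ e + 4 g (ω₀ ⋯ ωₙ₋₁))` for `ω ∈ {0, 1}^ℕ`. The first set is the one with `κ = 1`, the
second the one with `κ = 0`, and deleting the `e`-component maps the first onto the second.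

*Projections.* The functional `v` maps the point with code `ω` to the sum
`∑ₙ 2⁻ⁿ⁻¹ ωₙ (α + d (ω₀ ⋯ ωₙ₋₁))` with `α = κ ⟪v, e⟫` and `d w = 4 ⟪v, g w⟫`, and `d` is square
summable over all words. Since there are `2ⁿ` words of length `n`, the Cauchy-Schwarz inequality
makes the average of `|d w|` over them, and hence the length lost to overlaps of the projected
pieces of generation `n`, at most of order `2^(-n/2)`. This is summable, and the projection
satisfies the area formula with the constant Jacobian `|α|` with respect to the fair coin measure
on codes (`volume_approx_ge`, `lintegral_genMult_bounds`, `lintegral_mult`). Had the words of each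
length shared a single direction, the losses would not be summable for every square summable `d`.

So for `κ = 1` the coin measure and the constant tangent `e` satisfy the projection formula. For
`κ = 0` every projection is null; the measure zero satisfies the formula, and no other measure
does, because no line is orthogonal to all vectors of the basis
(`measure_eq_zero_of_satisfiesProjectionFormula`).

*Hausdorff measure.* The direction `g w` separates the two pieces below `w`, so the distance of two
points whose codes first differ at `n` is comparable to `2⁻ⁿ`. By self-similarity `ℋ¹` restricted to
the limit set is a multiple of the coin measure (`hausdorffMeasure_restrict_range`). The multiple
is finite, and the factor `4` in front of `g w` makes it at least `2`.

*Unrectifiability.* The limit set is ultrametric up to bounded factors. A Lipschitz curve moves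
between its pieces only across gaps in the set of parameters mapped to the limit set, and almost
every point of that set is a density point, so the curve meets the limit set in an `ℋ¹`-null set
(`dist_le_gap`, `hausdorffMeasure_image_eq_zero_of_dist_le_gaps`).
-/

/-! ### Codes, tree sums and the fair coin measure -/

namespace BinaryTree

/-- Infinite binary codes, indexing the points of the limit sets. -/
abbrev Code : Type := ℕ → Fin 2

/-- Prepend a digit to a code. -/
def cons (a : Fin 2) (ω : Code) : Code
  | 0 => a
  | n + 1 => ω n

/-- Drop the first digit of a code. -/
def tail (ω : Code) : Code := fun n => ω (n + 1)

/-- The word formed by the first `n` digits of a code. -/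
def pre : Code → ℕ → List (Fin 2)
  | _, 0 => []
  | ω, n + 1 => ω 0 :: pre (tail ω) n

@[simp] theorem cons_zero (a : Fin 2) (ω : Code) : cons a ω 0 = a := rfl
@[simp] theorem cons_succ (a : Fin 2) (ω : Code) (n : ℕ) : cons a ω (n + 1) = ω n := rfl
@[simp] theorem tail_apply (ω : Code) (n : ℕ) : tail ω n = ω (n + 1) := rfl
@[simp] theorem tail_cons (a : Fin 2) (ω : Code) : tail (cons a ω) = ω := rfl

@[simp] theorem cons_tail (ω : Code) : cons (ω 0) (tail ω) = ω := by
  funext n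
  cases n <;> rfl

theorem cons_injective (a : Fin 2) : Function.Injective (cons a) := fun ω ω' h => by
  rw [← tail_cons a ω, h, tail_cons]

theorem tail_iterate_apply (ω : Code) (n k : ℕ) : (tail^[n] ω) k = ω (n + k) := by
  induction n generalizing ω with
  | zero => simp
  | succ n ih => rw [Function.iterate_succ_apply, ih, tail_apply]; congr 1; omega

theorem tail_tail_iterate (ω : Code) (n : ℕ) : tail (tail^[n] ω) = tail^[n + 1] ω :=
  (Function.iterate_succ_apply' tail n ω).symm

theorem image_cons (a : Fin 2) (B : Set Code) : cons a '' B = {ω | ω 0 = a ∧ tail ω ∈ B} := by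
  ext ω
  constructor
  · rintro ⟨η, hη, rfl⟩
    exact ⟨rfl, hη⟩
  · rintro ⟨rfl, h⟩
    exact ⟨tail ω, h, cons_tail ω⟩

theorem cylinder_succ (ω : Code) (n : ℕ) :
    PiNat.cylinder ω (n + 1) = cons (ω 0) '' PiNat.cylinder (tail ω) n := by
  rw [image_cons]
  ext η
  simp only [PiNat.mem_cylinder_iff, mem_ofPred_eq, tail_apply]
  constructor
  · exact fun h => ⟨h 0 (by omega), fun i hi => h (i + 1) (by omega)⟩
  · rintro ⟨h0, h⟩ (_ | i) hi
    · exact h0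
    · exact h i (by omega)

section Sum

variable {E F : Type*} [NormedAddCommGroup E] [NormedSpace ℝ E]
  [NormedAddCommGroup F] [NormedSpace ℝ F]

/-- The point with code `ω` of the tree sum with increments `c`: at generation `n` the digit `1`
adds `2⁻ⁿ⁻¹ c w`, where `w` is the word of the preceding digits. -/
noncomputable def treeSum (c : List (Fin 2) → E) (ω : Code) : E :=
  ∑' n, (1 / 2 : ℝ) ^ (n + 1) • (if ω n = 1 then c (pre ω n) else 0)

/-- The increments below the first-generation word `a`. -/
def shift {X : Type*} (a : Fin 2) (c : List (Fin 2) → X) : List (Fin 2) → X := fun w => c (a :: w)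

theorem hasSum_half : HasSum (fun n : ℕ => (1 / 2 : ℝ) ^ (n + 1)) 1 := by
  simpa [pow_succ] using hasSum_geometric_two.mul_right (1 / 2 : ℝ)

theorem norm_term_le {c : List (Fin 2) → E} {M : ℝ} (hc : ∀ w, ‖c w‖ ≤ M) (ω : Code) (n : ℕ) :
    ‖(1 / 2 : ℝ) ^ (n + 1) • (if ω n = 1 then c (pre ω n) else 0)‖ ≤ (1 / 2 : ℝ) ^ (n + 1) * M := by
  rw [norm_smul, Real.norm_of_nonneg (by positivity)]
  gcongr
  split_ifs
  · exact hc _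
  · rw [norm_zero]; exact (norm_nonneg _).trans (hc [])

theorem summable_term [CompleteSpace E] {c : List (Fin 2) → E} {M : ℝ} (hc : ∀ w, ‖c w‖ ≤ M)
    (ω : Code) :
    Summable fun n => (1 / 2 : ℝ) ^ (n + 1) • (if ω n = 1 then c (pre ω n) else 0) :=
  Summable.of_norm_bounded (hasSum_half.summable.mul_right M) (norm_term_le hc ω)

theorem norm_treeSum_le {c : List (Fin 2) → E} {M : ℝ} (hc : ∀ w, ‖c w‖ ≤ M)
    (ω : Code) : ‖treeSum c ω‖ ≤ M := by
  have h := hasSum_half.mul_right M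
  rw [one_mul] at h
  exact tsum_of_norm_bounded h (norm_term_le hc ω)

omit [NormedSpace ℝ E] in
theorem norm_shift_le {c : List (Fin 2) → E} {M : ℝ} (hc : ∀ w, ‖c w‖ ≤ M) (a : Fin 2) :
    ∀ w, ‖shift a c w‖ ≤ M := fun w => hc (a :: w)

theorem treeSum_cons [CompleteSpace E] {c : List (Fin 2) → E} {M : ℝ} (hc : ∀ w, ‖c w‖ ≤ M)
    (a : Fin 2) (ω : Code) :
    treeSum c (cons a ω) =
      (1 / 2 : ℝ) • ((if a = 1 then c [] else 0) + treeSum (shift a c) ω) := by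
  rw [treeSum, (summable_term hc _).tsum_eq_zero_add, smul_add, treeSum,
    ← (summable_term (norm_shift_le hc a) ω).tsum_const_smul]
  congr 1
  · by_cases h : a = 1 <;> simp [pre, h]
  · refine tsum_congr fun n => ?_
    rw [smul_smul, pow_succ' _ (n + 1)]
    rfl

theorem treeSum_eq_tail [CompleteSpace E] {c : List (Fin 2) → E} {M : ℝ} (hc : ∀ w, ‖c w‖ ≤ M)
    (ω : Code) :
    treeSum c ω =
      (1 / 2 : ℝ) • ((if ω 0 = 1 then c [] else 0) + treeSum (shift (ω 0) c) (tail ω)) := by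
  conv_lhs => rw [← cons_tail ω]
  exact treeSum_cons hc _ _

theorem map_treeSum [CompleteSpace E] (L : E →L[ℝ] F) {c : List (Fin 2) → E} {M : ℝ}
    (hc : ∀ w, ‖c w‖ ≤ M) (ω : Code) : L (treeSum c ω) = treeSum (fun w => L (c w)) ω := by
  rw [treeSum, L.map_tsum (summable_term hc ω), treeSum]
  refine tsum_congr fun n => ?_
  rw [map_smul]
  split_ifs <;> simp

theorem treeSum_mem_Icc {c : List (Fin 2) → ℝ} {l u : ℝ} (hl : l ≤ 0) (hu : 0 ≤ u)
    (hc : ∀ w, c w ∈ Icc l u) (ω : Code) : treeSum c ω ∈ Icc l u := by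
  have hb : ∀ w, ‖c w‖ ≤ max (-l) u := fun w => by
    rw [Real.norm_eq_abs, abs_le]
    have := hc w
    constructor
    · linarith [le_max_left (-l) u, this.1]
    · exact this.2.trans (le_max_right _ _)
  have hs := summable_term hb ω
  have ht : ∀ n, (if ω n = 1 then c (pre ω n) else 0) ∈ Icc l u := fun n => by
    split_ifs
    · exact hc _
    · exact ⟨hl, hu⟩
  constructor
  · have h := hasSum_half.mul_right l
    rw [one_mul] at h
    exact hasSum_le (fun n => mul_le_mul_of_nonneg_left (ht n).1 (by positivity)) h hs.hasSum
  · have h := hasSum_half.mul_right u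
    rw [one_mul] at h
    exact hasSum_le (fun n => mul_le_mul_of_nonneg_left (ht n).2 (by positivity)) hs.hasSum h

theorem norm_treeSum_sub_le [CompleteSpace E] {M : ℝ} (n : ℕ) {c : List (Fin 2) → E}
    (hc : ∀ w, ‖c w‖ ≤ M) {ω ω' : Code} (h : ω' ∈ PiNat.cylinder ω n) :
    ‖treeSum c ω' - treeSum c ω‖ ≤ 2 * M * (1 / 2) ^ n := by
  induction n generalizing c ω ω' with
  | zero =>
    calc _ ≤ ‖treeSum c ω'‖ + ‖treeSum c ω‖ := norm_sub_le _ _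
      _ ≤ M + M := add_le_add (norm_treeSum_le hc _) (norm_treeSum_le hc _)
      _ = _ := by ring
  | succ n ih =>
    rw [cylinder_succ, image_cons] at h
    have h2 := ih (norm_shift_le hc (ω 0)) h.2
    rw [treeSum_eq_tail hc ω, treeSum_eq_tail hc ω', h.1, ← smul_sub, add_sub_add_left_eq_sub,
      norm_smul, Real.norm_of_nonneg (by norm_num), pow_succ]
    linarith

theorem continuous_treeSum [CompleteSpace E] {c : List (Fin 2) → E} {M : ℝ}
    (hc : ∀ w, ‖c w‖ ≤ M) : Continuous (treeSum c) := by
  rw [continuous_iff_continuousAt]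
  intro ω
  rw [ContinuousAt, tendsto_iff_norm_sub_tendsto_zero, Metric.tendsto_nhds]
  intro ε hε
  have h0 : Tendsto (fun n : ℕ => 2 * M * (1 / 2 : ℝ) ^ n) atTop (𝓝 0) := by
    simpa using (tendsto_pow_atTop_nhds_zero_of_lt_one (r := (1 / 2 : ℝ)) (by norm_num)
      (by norm_num)).const_mul (2 * M)
  obtain ⟨n, hn⟩ := (h0.eventually (gt_mem_nhds hε)).exists
  filter_upwards [(PiNat.isOpen_cylinder _ ω n).mem_nhds (PiNat.self_mem_cylinder ω n)] with η hη
  rw [dist_zero_right, norm_norm]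
  exact (norm_treeSum_sub_le n hc hη).trans_lt hn

end Sum

section Coin

/-- The fair coin measure on codes. -/
noncomputable def coin : Measure Code :=
  Measure.infinitePi fun _ => ProbabilityTheory.uniformOn (univ : Set (Fin 2))

instance : IsProbabilityMeasure coin := by
  unfold coin
  have : IsProbabilityMeasure (ProbabilityTheory.uniformOn (univ : Set (Fin 2))) :=
    ProbabilityTheory.isProbabilityMeasure_uniformOn finite_univ univ_nonempty
  infer_instance

theorem coin_cylinder (ω : Code) (n : ℕ) : coin (PiNat.cylinder ω n) = 2⁻¹ ^ n := by
  have : IsProbabilityMeasure (ProbabilityTheory.uniformOn (univ : Set (Fin 2))) :=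
    ProbabilityTheory.isProbabilityMeasure_uniformOn finite_univ univ_nonempty
  rw [coin, PiNat.cylinder_eq_pi, Measure.infinitePi_pi]
  · simp [ProbabilityTheory.uniformOn_univ]
  · exact fun i _ => MeasurableSet.singleton _

/-- The cylinders together with the empty set. -/
def cylinders : Set (Set Code) := {B | B = ∅ ∨ ∃ ω n, B = PiNat.cylinder ω n}

theorem isPiSystem_cylinders : IsPiSystem cylinders := by
  rintro s (rfl | ⟨ω, n, rfl⟩) t (rfl | ⟨η, m, rfl⟩) hst
  · simp at hst
  · simp at hst
  · simp at hst
  obtain ⟨ζ, h1, h2⟩ := hst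
  right
  rw [← PiNat.mem_cylinder_iff_eq.1 h1, ← PiNat.mem_cylinder_iff_eq.1 h2]
  refine ⟨ζ, max n m, ?_⟩
  ext θ
  simp only [mem_inter_iff, PiNat.mem_cylinder_iff, lt_max_iff]
  grind

theorem borel_eq_generateFrom_cylinders :
    (inferInstance : MeasurableSpace Code) = MeasurableSpace.generateFrom cylinders := by
  have h1 : (inferInstance : MeasurableSpace Code) = borel Code := BorelSpace.measurable_eq
  refine h1.trans ?_
  rw [(PiNat.isTopologicalBasis_cylinders fun _ => Fin 2).borel_eq_generateFrom]
  apply le_antisymm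
  · apply MeasurableSpace.generateFrom_mono
    rintro s ⟨ω, n, rfl⟩
    exact Or.inr ⟨ω, n, rfl⟩
  · apply MeasurableSpace.generateFrom_le
    rintro s (rfl | ⟨ω, n, rfl⟩)
    · exact MeasurableSpace.GenerateMeasurable.empty
    · exact MeasurableSpace.GenerateMeasurable.basic _ ⟨ω, n, rfl⟩

/-- A finite measure that gives the same mass to all cylinders of a generation is a multiple of
the fair coin measure. -/
theorem eq_smul_coin {m : Measure Code} [IsFiniteMeasure m]
    (h : ∀ ω n, m (PiNat.cylinder ω n) = 2⁻¹ ^ n * m univ) : m = m univ • coin := by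
  refine ext_of_generate_finite cylinders borel_eq_generateFrom_cylinders isPiSystem_cylinders
    ?_ (by simp)
  rintro s (rfl | ⟨ω, n, rfl⟩)
  · simp
  · rw [h, Measure.smul_apply, coin_cylinder, smul_eq_mul, mul_comm]

end Coin

end BinaryTree

/-! ### The area formula for projected tree sums -/

namespace BinaryTree

section Energy

/-- The `ℓ²` norm of a family indexed by words. -/
noncomputable def energy (d : List (Fin 2) → ℝ) : ℝ := √(∑' w, d w ^ 2)

theorem energy_nonneg (d : List (Fin 2) → ℝ) : 0 ≤ energy d := Real.sqrt_nonneg _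

theorem energy_sq (d : List (Fin 2) → ℝ) : energy d ^ 2 = ∑' w, d w ^ 2 :=
  Real.sq_sqrt (tsum_nonneg fun _ => sq_nonneg _)

variable {d : List (Fin 2) → ℝ}

theorem abs_le_energy (hd : Summable fun w => d w ^ 2) (w : List (Fin 2)) :
    |d w| ≤ energy d :=
  Real.abs_le_sqrt (hd.le_tsum w fun _ _ => sq_nonneg _)

theorem summable_shift (hd : Summable fun w => d w ^ 2) (a : Fin 2) :
    Summable fun w => shift a d w ^ 2 :=
  hd.comp_injective (i := fun w => a :: w) fun _ _ h => (List.cons.inj h).2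

/-- The subtrees below the two first-generation words are disjoint. -/
theorem energy_shift_sq_add_le (hd : Summable fun w => d w ^ 2) :
    energy (shift 0 d) ^ 2 + energy (shift 1 d) ^ 2 ≤ energy d ^ 2 := by
  rw [energy_sq, energy_sq, energy_sq]
  have hi : Function.Injective fun p : Fin 2 × List (Fin 2) => p.1 :: p.2 := by
    rintro ⟨a, w⟩ ⟨b, v⟩ h
    simpa using h
  have hs : Summable fun p : Fin 2 × List (Fin 2) => d (p.1 :: p.2) ^ 2 := hd.comp_injective hi
  have h := hs.tsum_le_tsum_of_inj _ hi (fun _ _ => sq_nonneg _) (fun _ => le_rfl) hd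
  rwa [hs.tsum_prod, tsum_fintype, Fin.sum_univ_two] at h

theorem energy_shift_le (hd : Summable fun w => d w ^ 2) (a : Fin 2) :
    energy (shift a d) ≤ energy d := by
  refine le_of_sq_le_sq ?_ (energy_nonneg d)
  have h := energy_shift_sq_add_le hd
  fin_cases a
  · exact le_trans (le_add_of_nonneg_right (sq_nonneg _)) h
  · exact le_trans (le_add_of_nonneg_left (sq_nonneg _)) h

/-- Halving of scales beats the growth of the number of words: the average over the two subtrees
of the energy decays geometrically. -/
theorem energy_shift_add_le (hd : Summable fun w => d w ^ 2) :
    energy (shift 0 d) + energy (shift 1 d) ≤ 3 / 2 * energy d := by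
  have h := energy_shift_sq_add_le hd
  have h0 := energy_nonneg (shift 0 d)
  have h1 := energy_nonneg (shift 1 d)
  have h2 := energy_nonneg d
  refine le_of_sq_le_sq ?_ (by positivity)
  nlinarith [sq_nonneg (energy (shift 0 d) - energy (shift 1 d))]

end Energy

/-- The increments `α + d w`: a constant drift perturbed by a square summable family. -/
def inc (α : ℝ) (d : List (Fin 2) → ℝ) : List (Fin 2) → ℝ := fun w => α + d w

/-- The contribution of the first digit, before halving. -/
def off (α : ℝ) (d : List (Fin 2) → ℝ) (a : Fin 2) : ℝ := if a = 1 then α + d [] else 0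

@[simp] theorem off_zero (α : ℝ) (d : List (Fin 2) → ℝ) : off α d 0 = 0 := rfl
@[simp] theorem off_one (α : ℝ) (d : List (Fin 2) → ℝ) : off α d 1 = α + d [] := rfl

/-- The inverse of the contraction that carries the projection of the whole limit set onto the
projection of a first-generation piece. -/
def expand (α : ℝ) (d : List (Fin 2) → ℝ) (a : Fin 2) (y : ℝ) : ℝ := 2 * y - off α d a

/-- `expand` as a homeomorphism. -/
noncomputable def expandHomeo (α : ℝ) (d : List (Fin 2) → ℝ) (a : Fin 2) : ℝ ≃ₜ ℝ :=
  (Homeomorph.mulLeft₀ (2 : ℝ) two_ne_zero).trans (Homeomorph.subRight (off α d a))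

theorem coe_expandHomeo (α : ℝ) (d : List (Fin 2) → ℝ) (a : Fin 2) :
    ⇑(expandHomeo α d a) = expand α d a := rfl

theorem continuous_expand (α : ℝ) (d : List (Fin 2) → ℝ) (a : Fin 2) :
    Continuous (expand α d a) := (expandHomeo α d a).continuous

theorem map_expand (α : ℝ) (d : List (Fin 2) → ℝ) (a : Fin 2) :
    Measure.map (expand α d a) volume = (2⁻¹ : ℝ≥0∞) • volume := by
  have h : expand α d a = (fun y => y - off α d a) ∘ fun y => 2 * y := rfl
  have hm : Measurable fun y : ℝ => y - off α d a := measurable_id.sub_const _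
  rw [h, ← Measure.map_map hm (measurable_const_mul 2),
    Real.map_volume_mul_left two_ne_zero, Measure.map_smul,
    (measurePreserving_sub_right volume (off α d a)).map_eq]
  rw [abs_of_nonneg (by norm_num), ENNReal.ofReal_inv_of_pos (by norm_num)]
  norm_num

theorem lintegral_expand (α : ℝ) (d : List (Fin 2) → ℝ) (a : Fin 2) (f : ℝ → ℝ≥0∞) :
    ∫⁻ y, f (expand α d a y) = 2⁻¹ * ∫⁻ y, f y := by
  have h := (expandHomeo α d a).measurableEmbedding.lintegral_map (μ := volume) f
  rw [coe_expandHomeo, map_expand, lintegral_smul_measure] at h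
  exact h.symm

theorem volume_expand (α : ℝ) (d : List (Fin 2) → ℝ) (a : Fin 2) (s : Set ℝ) :
    volume (expand α d a ⁻¹' s) = 2⁻¹ * volume s := by
  have h := (expandHomeo α d a).measurableEmbedding.map_apply (μ := volume) s
  rw [coe_expandHomeo, map_expand, Measure.smul_apply] at h
  exact h.symm

theorem aemeasurable_expand (α : ℝ) (d : List (Fin 2) → ℝ) (a : Fin 2) {f : ℝ → ℝ≥0∞}
    (hf : AEMeasurable f) : AEMeasurable fun y => f (expand α d a y) := by
  refine AEMeasurable.comp_measurable (g := f) ?_ (continuous_expand α d a).measurable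
  rw [map_expand]
  exact hf.smul_measure _

section Projection

variable {α : ℝ} {d : List (Fin 2) → ℝ}

theorem norm_inc_le (hd : Summable fun w => d w ^ 2) (w : List (Fin 2)) :
    ‖inc α d w‖ ≤ |α| + energy d :=
  (abs_add_le _ _).trans (add_le_add_right (abs_le_energy hd w) _)

theorem treeSum_inc_cons (hd : Summable fun w => d w ^ 2) (a : Fin 2) (ω : Code) :
    treeSum (inc α d) (cons a ω) = (off α d a + treeSum (inc α (shift a d)) ω) / 2 := by
  rw [treeSum_cons (norm_inc_le hd), smul_eq_mul, div_eq_mul_one_div (off α d a + _), mul_comm]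
  rfl

theorem treeSum_inc_cons_eq_iff (hd : Summable fun w => d w ^ 2) (a : Fin 2) (ω : Code) (y : ℝ) :
    treeSum (inc α d) (cons a ω) = y ↔ treeSum (inc α (shift a d)) ω = expand α d a y := by
  rw [treeSum_inc_cons hd, expand, div_eq_iff two_ne_zero]
  constructor <;> intro h <;> linarith

theorem continuous_treeSum_inc (hd : Summable fun w => d w ^ 2) :
    Continuous (treeSum (inc α d)) := continuous_treeSum (norm_inc_le hd)

theorem isCompact_range_treeSum (hd : Summable fun w => d w ^ 2) :
    IsCompact (range (treeSum (inc α d))) := isCompact_range (continuous_treeSum_inc hd)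

theorem treeSum_inc_mem (hα : 0 ≤ α) (hd : Summable fun w => d w ^ 2) (ω : Code) :
    treeSum (inc α d) ω ∈ Icc (-energy d) (α + energy d) := by
  have h0 := energy_nonneg d
  refine treeSum_mem_Icc (by linarith) (by linarith) (fun w => ?_) ω
  have := abs_le.1 (abs_le_energy hd w)
  exact ⟨by simp only [inc]; linarith, by simp only [inc]; linarith⟩

/-- The union of the generation `k` hulls, which decreases to the range of `treeSum (inc α d)`. -/
def approx (α : ℝ) : ℕ → (List (Fin 2) → ℝ) → Set ℝ
  | 0, d => Icc (-energy d) (α + energy d)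
  | k + 1, d => expand α d 0 ⁻¹' approx α k (shift 0 d) ∪ expand α d 1 ⁻¹' approx α k (shift 1 d)

theorem measurableSet_approx (k : ℕ) (d : List (Fin 2) → ℝ) : MeasurableSet (approx α k d) := by
  induction k generalizing d with
  | zero => exact measurableSet_Icc
  | succ k ih =>
    exact ((continuous_expand _ _ _).measurable (ih _)).union
      ((continuous_expand _ _ _).measurable (ih _))

theorem approx_one_subset (hα : 0 ≤ α) (hd : Summable fun w => d w ^ 2) :
    approx α 1 d ⊆ approx α 0 d := by
  have h0 := energy_nonneg d
  have h1 := energy_shift_le hd 0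
  have h2 := energy_shift_le hd 1
  have h3 := abs_le.1 (abs_le_energy hd [])
  rintro y (hy | hy)
  all_goals
    simp only [approx, expand, mem_preimage, mem_Icc, off_zero, off_one] at hy ⊢
    constructor <;> linarith

theorem approx_succ_subset (hα : 0 ≤ α) (k : ℕ) (hd : Summable fun w => d w ^ 2) :
    approx α (k + 1) d ⊆ approx α k d := by
  induction k generalizing d with
  | zero => exact approx_one_subset hα hd
  | succ k ih =>
    exact union_subset_union (preimage_mono (ih (summable_shift hd 0)))
      (preimage_mono (ih (summable_shift hd 1)))

theorem antitone_approx (hα : 0 ≤ α) (hd : Summable fun w => d w ^ 2) :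
    Antitone fun k => approx α k d := antitone_nat_of_succ_le fun k => approx_succ_subset hα k hd

theorem volume_approx_ne_top (hα : 0 ≤ α) (k : ℕ) (hd : Summable fun w => d w ^ 2) :
    volume (approx α k d) ≠ ∞ :=
  ((measure_mono (antitone_approx hα hd (zero_le (a := k)))).trans_lt measure_Icc_lt_top).ne

/-- The hulls of the two first-generation pieces overlap in an interval of length at most
`3/2 * energy d`, so only a controlled amount of length is lost in each generation. The constant
`6` solves `3/4 * c + 3/2 = c`, where `3/4` is the factor from `energy_shift_add_le` after halving. -/
theorem volume_approx_ge (hα : 0 ≤ α) (k : ℕ) (hd : Summable fun w => d w ^ 2) :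
    α - 6 * energy d ≤ volume.real (approx α k d) := by
  have h0 := energy_nonneg d
  induction k generalizing d with
  | zero =>
    rw [approx, Real.volume_real_Icc_of_le (by linarith)]
    linarith
  | succ k ih =>
    have hd0 := summable_shift hd 0
    have hd1 := summable_shift hd 1
    have half : ∀ a (s : Set ℝ), volume.real (expand α d a ⁻¹' s) = volume.real s / 2 :=
      fun a s => by
        rw [measureReal_def, volume_expand, ENNReal.toReal_mul, measureReal_def]
        simp only [ENNReal.toReal_inv, ENNReal.toReal_ofNat]
        ring
    have fin : ∀ a, volume (expand α d a ⁻¹' approx α k (shift a d)) ≠ ∞ := fun a => by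
      rw [volume_expand]
      exact ENNReal.mul_ne_top (by norm_num) (volume_approx_ne_top hα k (summable_shift hd a))
    have hU := measureReal_union_add_inter (μ := volume)
      (s := expand α d 0 ⁻¹' approx α k (shift 0 d))
      ((continuous_expand α d 1).measurable (measurableSet_approx (α := α) k (shift 1 d)))
      (fin 0) (fin 1)
    have hI : expand α d 0 ⁻¹' approx α k (shift 0 d) ∩ expand α d 1 ⁻¹' approx α k (shift 1 d) ⊆
        Icc ((α + d [] - energy (shift 1 d)) / 2) ((α + energy (shift 0 d)) / 2) := by
      rintro y ⟨hy0, hy1⟩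
      have hy0' := antitone_approx hα hd0 (zero_le (a := k)) hy0
      have hy1' := antitone_approx hα hd1 (zero_le (a := k)) hy1
      simp only [approx, expand, mem_Icc, off_zero, off_one] at hy0' hy1' ⊢
      constructor <;> linarith
    have hI2 := measureReal_mono hI (measure_Icc_lt_top (μ := (volume : Measure ℝ))).ne
    rw [Real.volume_real_Icc] at hI2
    have h3 := abs_le.1 (abs_le_energy hd [])
    have hI3 : max ((α + energy (shift 0 d)) / 2 - (α + d [] - energy (shift 1 d)) / 2) 0 ≤
        3 / 2 * energy d :=
      max_le (by linarith [energy_shift_le hd 0, energy_shift_le hd 1]) (by linarith)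
    rw [half, half] at hU
    have e0 := ih hd0 (energy_nonneg _)
    have e1 := ih hd1 (energy_nonneg _)
    rw [approx]
    linarith [energy_shift_add_le hd]

theorem exists_treeSum_near_of_mem_approx {C : ℝ} (hα : 0 ≤ α) (k : ℕ)
    (hd : Summable fun w => d w ^ 2) (hC : α + 2 * energy d ≤ C) {y : ℝ} (hy : y ∈ approx α k d) :
    ∃ ω, |treeSum (inc α d) ω - y| ≤ C * (1 / 2) ^ k := by
  induction k generalizing d y with
  | zero =>
    refine ⟨fun _ => 0, ?_⟩
    have h := treeSum_inc_mem hα hd fun _ => 0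
    simp only [approx, mem_Icc] at hy h
    rw [abs_le]
    constructor <;> linarith
  | succ k ih =>
    have step : ∀ a, expand α d a y ∈ approx α k (shift a d) →
        ∃ ω, |treeSum (inc α d) ω - y| ≤ C * (1 / 2) ^ (k + 1) := fun a ha => by
      obtain ⟨ω, hω⟩ := ih (summable_shift hd a) (by linarith [energy_shift_le hd a]) ha
      refine ⟨cons a ω, ?_⟩
      rw [treeSum_inc_cons hd]
      rw [expand] at hω
      have e : (off α d a + treeSum (inc α (shift a d)) ω) / 2 - y =
        (treeSum (inc α (shift a d)) ω - (2 * y - off α d a)) / 2 := by ring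
      rw [e, abs_div, abs_two, pow_succ]
      linarith
    rcases hy with hy | hy
    · exact step 0 hy
    · exact step 1 hy

theorem iInter_approx_subset (hα : 0 ≤ α) (hd : Summable fun w => d w ^ 2) :
    ⋂ k, approx α k d ⊆ range (treeSum (inc α d)) := by
  intro y hy
  rw [mem_iInter] at hy
  rw [← (isCompact_range_treeSum (α := α) hd).isClosed.closure_eq, Metric.mem_closure_range_iff]
  intro ε hε
  have h0 : Tendsto (fun n : ℕ => (α + 2 * energy d) * (1 / 2 : ℝ) ^ n) atTop (𝓝 0) := by
    simpa using (tendsto_pow_atTop_nhds_zero_of_lt_one (r := (1 / 2 : ℝ)) (by norm_num)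
      (by norm_num)).const_mul (α + 2 * energy d)
  obtain ⟨n, hn⟩ := (h0.eventually (gt_mem_nhds hε)).exists
  obtain ⟨ω, hω⟩ := exists_treeSum_near_of_mem_approx hα n hd le_rfl (hy n)
  refine ⟨ω, ?_⟩
  rw [dist_comm, Real.dist_eq]
  exact hω.trans_lt hn

theorem volume_range_ge (hα : 0 ≤ α) (hd : Summable fun w => d w ^ 2) :
    ENNReal.ofReal (α - 6 * energy d) ≤ volume (range (treeSum (inc α d))) := by
  refine le_trans ?_ (measure_mono (iInter_approx_subset hα hd))
  have h := tendsto_measure_iInter_atTop (μ := volume)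
    (fun k => (measurableSet_approx (α := α) k d).nullMeasurableSet) (antitone_approx hα hd)
    ⟨0, volume_approx_ne_top hα 0 hd⟩
  refine ge_of_tendsto' h fun k => ?_
  exact ENNReal.ofReal_le_of_le_toReal (volume_approx_ge hα k hd)

theorem volume_range_le (hα : 0 ≤ α) (hd : Summable fun w => d w ^ 2) :
    volume (range (treeSum (inc α d))) ≤ ENNReal.ofReal (α + 2 * energy d) := by
  calc _ ≤ volume (Icc (-energy d) (α + energy d)) :=
        measure_mono (range_subset_iff.2 (treeSum_inc_mem hα hd))
    _ = _ := by rw [Real.volume_Icc]; congr 1; ring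

/-- The number of points of `B` that are projected to `y`. -/
noncomputable def mult (α : ℝ) (d : List (Fin 2) → ℝ) (B : Set Code) (y : ℝ) : ℝ≥0∞ :=
  ({ω ∈ B | treeSum (inc α d) ω = y}.encard : ℝ≥0∞)

/-- The number of generation `k` pieces whose projection contains `y`. -/
noncomputable def genMult (α : ℝ) : ℕ → (List (Fin 2) → ℝ) → ℝ → ℝ≥0∞
  | 0, d, y => (range (treeSum (inc α d))).indicator 1 y
  | k + 1, d, y =>
    genMult α k (shift 0 d) (expand α d 0 y) + genMult α k (shift 1 d) (expand α d 1 y)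

theorem measurable_genMult (k : ℕ) (hd : Summable fun w => d w ^ 2) :
    Measurable (genMult α k d) := by
  induction k generalizing d with
  | zero =>
    exact measurable_one.indicator (isCompact_range_treeSum hd).isClosed.measurableSet
  | succ k ih =>
    exact ((ih (summable_shift hd 0)).comp (continuous_expand _ _ _).measurable).add
      ((ih (summable_shift hd 1)).comp (continuous_expand _ _ _).measurable)

theorem mult_image_cons (hd : Summable fun w => d w ^ 2) (a : Fin 2) (B : Set Code) (y : ℝ) :
    mult α d (cons a '' B) y = mult α (shift a d) B (expand α d a y) := by
  have h : {ω ∈ cons a '' B | treeSum (inc α d) ω = y} =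
      cons a '' {ω ∈ B | treeSum (inc α (shift a d)) ω = expand α d a y} := by
    ext ω
    constructor
    · rintro ⟨⟨η, hη, rfl⟩, h⟩
      exact ⟨η, ⟨hη, (treeSum_inc_cons_eq_iff hd a η y).1 h⟩, rfl⟩
    · rintro ⟨η, ⟨hη, h⟩, rfl⟩
      exact ⟨⟨η, hη, rfl⟩, (treeSum_inc_cons_eq_iff hd a η y).2 h⟩
  rw [mult, h, (cons_injective a).encard_image, mult]

theorem mult_union {B C : Set Code} (h : Disjoint B C) (y : ℝ) :
    mult α d (B ∪ C) y = mult α d B y + mult α d C y := by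
  have e : {ω ∈ B ∪ C | treeSum (inc α d) ω = y} =
      {ω ∈ B | treeSum (inc α d) ω = y} ∪ {ω ∈ C | treeSum (inc α d) ω = y} := by
    ext ω
    simp only [mem_union, mem_ofPred_eq]
    tauto
  rw [mult, e, encard_union_eq (h.mono (fun _ h => h.1) (fun _ h => h.1)), ENat.toENNReal_add]
  rfl

theorem univ_eq_union_image_cons : (univ : Set Code) = cons 0 '' univ ∪ cons 1 '' univ := by
  ext ω
  simp only [image_cons, mem_univ, mem_union, mem_ofPred_eq, and_true, true_iff]
  generalize ω 0 = a
  fin_cases a <;> simp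

theorem disjoint_image_cons (B C : Set Code) : Disjoint (cons 0 '' B) (cons 1 '' C) := by
  rw [image_cons, image_cons, Set.disjoint_left]
  rintro ω ⟨h, -⟩ ⟨h', -⟩
  rw [h] at h'
  exact absurd h' (by decide)

theorem mult_univ (hd : Summable fun w => d w ^ 2) (y : ℝ) :
    mult α d univ y =
      mult α (shift 0 d) univ (expand α d 0 y) + mult α (shift 1 d) univ (expand α d 1 y) := by
  conv_lhs => rw [univ_eq_union_image_cons]
  rw [mult_union (disjoint_image_cons _ _), mult_image_cons hd, mult_image_cons hd]

theorem genMult_zero_le (d : List (Fin 2) → ℝ) (y : ℝ) : genMult α 0 d y ≤ mult α d univ y := by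
  classical
  rw [genMult, indicator_apply]
  split_ifs with h
  · obtain ⟨ω, hω⟩ := h
    have : (1 : ℕ∞) ≤ {ω ∈ (univ : Set Code) | treeSum (inc α d) ω = y}.encard :=
      one_le_encard_iff_nonempty.2 ⟨ω, mem_univ _, hω⟩
    simpa [mult] using (ENat.toENNReal_le.2 this)
  · exact zero_le

theorem genMult_le (k : ℕ) (hd : Summable fun w => d w ^ 2) (y : ℝ) :
    genMult α k d y ≤ mult α d univ y := by
  induction k generalizing d y with
  | zero => exact genMult_zero_le d y
  | succ k ih =>
    rw [mult_univ hd, genMult]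
    exact add_le_add (ih (summable_shift hd 0) _) (ih (summable_shift hd 1) _)

theorem genMult_mono_succ (k : ℕ) (hd : Summable fun w => d w ^ 2) (y : ℝ) :
    genMult α k d y ≤ genMult α (k + 1) d y := by
  induction k generalizing d y with
  | zero =>
    have key : ∀ a (ω : Code), treeSum (inc α d) (cons a ω) = y →
        genMult α 0 (shift a d) (expand α d a y) = 1 := fun a ω h => by
      rw [genMult, indicator_of_mem (mem_range.2 ⟨ω, (treeSum_inc_cons_eq_iff hd a ω y).1 h⟩)]
      rfl
    by_cases h : y ∈ range (treeSum (inc α d))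
    · rw [genMult, indicator_of_mem h, genMult]
      obtain ⟨ω, hω⟩ := h
      rw [← cons_tail ω] at hω
      generalize ω 0 = a at hω
      fin_cases a
      · exact le_add_of_le_of_nonneg (key 0 _ hω).ge zero_le
      · exact le_add_of_nonneg_of_le zero_le (key 1 _ hω).ge
    · rw [genMult, indicator_of_notMem h]
      exact zero_le
  | succ k ih =>
    exact add_le_add (ih (summable_shift hd 0) _) (ih (summable_shift hd 1) _)

/-- Points of a fibre that are told apart by their first `k` digits lie in different pieces of
generation `k`. -/
theorem card_le_genMult (k : ℕ) (hd : Summable fun w => d w ^ 2) {y : ℝ} (s : Finset Code)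
    (hs : ∀ ω ∈ s, treeSum (inc α d) ω = y)
    (hk : ∀ ω ∈ s, ∀ η ∈ s, (∀ i < k, ω i = η i) → ω = η) :
    (s.card : ℝ≥0∞) ≤ genMult α k d y := by
  classical
  induction k generalizing d y s with
  | zero =>
    rcases s.eq_empty_or_nonempty with rfl | ⟨ω, hω⟩
    · simp
    · have h1 : s.card ≤ 1 := Finset.card_le_one.2 fun a ha b hb => hk a ha b hb (by simp)
      rw [genMult, indicator_of_mem (mem_range.2 ⟨ω, hs ω hω⟩)]
      change (s.card : ℝ≥0∞) ≤ 1
      exact_mod_cast h1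
  | succ k ih =>
    have part : ∀ a, ((s.filter fun ω => ω 0 = a).card : ℝ≥0∞) ≤
        genMult α k (shift a d) (expand α d a y) := fun a => by
      have hinj : Set.InjOn tail (s.filter fun ω => ω 0 = a : Finset Code) := by
        intro ω hω η hη h
        simp only [Finset.coe_filter, mem_ofPred_eq] at hω hη
        rw [← cons_tail ω, ← cons_tail η, h, hω.2, hη.2]
      rw [← Finset.card_image_of_injOn hinj]
      refine ih (summable_shift hd a) _ ?_ ?_
      · intro ω hω
        simp only [Finset.mem_image, Finset.mem_filter] at hω
        obtain ⟨η, ⟨hη, rfl⟩, rfl⟩ := hω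
        rw [← treeSum_inc_cons_eq_iff hd, cons_tail]
        exact hs η hη
      · intro ω hω η hη h
        simp only [Finset.mem_image, Finset.mem_filter] at hω hη
        obtain ⟨ω', ⟨hω', h0⟩, rfl⟩ := hω
        obtain ⟨η', ⟨hη', h0'⟩, rfl⟩ := hη
        rw [hk ω' hω' η' hη' fun i hi => ?_]
        rcases i with _ | i
        · rw [h0, h0']
        · exact h i (by omega)
    have hc := Finset.card_filter_add_card_filter_not (s := s) (fun ω : Code => ω 0 = 0)
    have hf : (s.filter fun ω : Code => ¬ ω 0 = 0) = s.filter fun ω => ω 0 = 1 := by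
      refine Finset.filter_congr fun ω _ => ?_
      generalize ω 0 = a
      fin_cases a <;> simp
    rw [hf] at hc
    rw [← hc, Nat.cast_add]
    exact add_le_add (part 0) (part 1)

theorem exists_separating_generation (s : Finset Code) :
    ∃ k, ∀ ω ∈ s, ∀ η ∈ s, (∀ i < k, ω i = η i) → ω = η := by
  classical
  refine ⟨(s ×ˢ s).sup fun p => PiNat.firstDiff p.1 p.2 + 1, fun ω hω η hη h => ?_⟩
  by_contra hne
  refine PiNat.apply_firstDiff_ne hne (h _ ?_)
  exact Finset.le_sup (f := fun p : Code × Code => PiNat.firstDiff p.1 p.2 + 1)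
    (Finset.mk_mem_product hω hη)

theorem encard_le_of_forall_finset {X : Type*} {s : Set X} {b : ℝ≥0∞}
    (h : ∀ t : Finset X, (t : Set X) ⊆ s → (t.card : ℝ≥0∞) ≤ b) : (s.encard : ℝ≥0∞) ≤ b := by
  rcases s.finite_or_infinite with hs | hs
  · have := h hs.toFinset (by simp)
    rw [hs.encard_eq_coe_toFinset_card]
    simpa using this
  · have : b = ∞ := ENNReal.eq_top_of_forall_nnreal_le fun r => by
      obtain ⟨n, hn⟩ := exists_nat_ge r
      obtain ⟨t, ht, htn⟩ := hs.exists_subset_card_eq n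
      refine le_trans ?_ (h t ht)
      rw [htn]
      exact_mod_cast hn
    rw [this]
    exact le_top

theorem mult_univ_eq_iSup (hd : Summable fun w => d w ^ 2) (y : ℝ) :
    mult α d univ y = ⨆ k, genMult α k d y := by
  refine le_antisymm (encard_le_of_forall_finset fun s hs => ?_) (iSup_le fun k => genMult_le k hd y)
  obtain ⟨k, hk⟩ := exists_separating_generation s
  exact (card_le_genMult k hd s (fun ω hω => (hs hω).2) hk).trans (le_iSup (fun k => genMult α k d y) k)

theorem lintegral_genMult_succ (k : ℕ) (hd : Summable fun w => d w ^ 2) :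
    ∫⁻ y, genMult α (k + 1) d y =
      2⁻¹ * (∫⁻ y, genMult α k (shift 0 d) y) + 2⁻¹ * ∫⁻ y, genMult α k (shift 1 d) y := by
  have hm : Measurable fun y => genMult α k (shift 0 d) (expand α d 0 y) :=
    (measurable_genMult k (summable_shift hd 0)).comp (continuous_expand α d 0).measurable
  simp only [genMult]
  rw [lintegral_add_left hm, lintegral_expand, lintegral_expand]

theorem lintegral_genMult_zero (hd : Summable fun w => d w ^ 2) :
    ∫⁻ y, genMult α 0 d y = volume (range (treeSum (inc α d))) := by
  simp only [genMult]
  exact lintegral_indicator_one (isCompact_range_treeSum hd).isClosed.measurableSet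

theorem lintegral_genMult_bounds (hα : 0 ≤ α) (k : ℕ) (hd : Summable fun w => d w ^ 2) :
    ENNReal.ofReal (α - 6 * energy d * (3 / 4) ^ k) ≤ ∫⁻ y, genMult α k d y ∧
      ∫⁻ y, genMult α k d y ≤ ENNReal.ofReal (α + 2 * energy d * (3 / 4) ^ k) := by
  induction k generalizing d with
  | zero =>
    rw [lintegral_genMult_zero hd, pow_zero, mul_one, mul_one]
    exact ⟨volume_range_ge hα hd, volume_range_le hα hd⟩
  | succ k ih =>
    have h0 := ih (summable_shift hd 0)
    have h1 := ih (summable_shift hd 1)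
    have hp : (0 : ℝ) ≤ (3 / 4) ^ k := by positivity
    have he := mul_le_mul_of_nonneg_right (energy_shift_add_le hd) hp
    have half : ∀ x : ℝ, (2⁻¹ : ℝ≥0∞) * ENNReal.ofReal x = ENNReal.ofReal (x / 2) := fun x => by
      rw [div_eq_inv_mul, ENNReal.ofReal_mul (by norm_num), ENNReal.ofReal_inv_of_pos (by norm_num)]
      norm_num
    rw [lintegral_genMult_succ k hd]
    constructor
    · refine le_trans ?_ (add_le_add (mul_le_mul_right h0.1 _) (mul_le_mul_right h1.1 _))
      rw [half, half]
      refine le_trans (ENNReal.ofReal_le_ofReal ?_) ENNReal.ofReal_add_le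
      rw [pow_succ]
      linarith
    · refine (add_le_add (mul_le_mul_right h0.2 _) (mul_le_mul_right h1.2 _)).trans ?_
      have e0 := mul_nonneg (energy_nonneg (shift 0 d)) hp
      have e1 := mul_nonneg (energy_nonneg (shift 1 d)) hp
      rw [half, half, ← ENNReal.ofReal_add (by linarith) (by linarith)]
      refine ENNReal.ofReal_le_ofReal ?_
      rw [pow_succ]
      linarith

theorem measurable_mult_univ (hd : Summable fun w => d w ^ 2) : Measurable (mult α d univ) := by
  have : mult α d univ = fun y => ⨆ k, genMult α k d y := funext (mult_univ_eq_iSup hd)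
  rw [this]
  exact Measurable.iSup fun k => measurable_genMult k hd

theorem lintegral_mult_univ (hα : 0 ≤ α) (hd : Summable fun w => d w ^ 2) :
    ∫⁻ y, mult α d univ y = ENNReal.ofReal α := by
  have hmono : ∀ y, Monotone fun k => genMult α k d y :=
    fun y => monotone_nat_of_le_succ fun k => genMult_mono_succ k hd y
  have h1 : Tendsto (fun k => ∫⁻ y, genMult α k d y) atTop (𝓝 (∫⁻ y, mult α d univ y)) := by
    refine lintegral_tendsto_of_tendsto_of_monotone
      (fun k => (measurable_genMult k hd).aemeasurable) (ae_of_all _ hmono) (ae_of_all _ fun y => ?_)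
    rw [mult_univ_eq_iSup hd]
    exact tendsto_atTop_iSup (hmono y)
  have hp := tendsto_pow_atTop_nhds_zero_of_lt_one (r := (3 / 4 : ℝ)) (by norm_num) (by norm_num)
  have h2 : Tendsto (fun k => ∫⁻ y, genMult α k d y) atTop (𝓝 (ENNReal.ofReal α)) := by
    refine tendsto_of_tendsto_of_tendsto_of_le_of_le ?_ ?_
      (fun k => (lintegral_genMult_bounds hα k hd).1) (fun k => (lintegral_genMult_bounds hα k hd).2)
    · refine ENNReal.tendsto_ofReal ?_
      simpa using (hp.const_mul (6 * energy d)).const_sub α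
    · refine ENNReal.tendsto_ofReal ?_
      simpa using (hp.const_mul (2 * energy d)).const_add α
  exact tendsto_nhds_unique h1 h2

theorem mult_cylinder (hα : 0 ≤ α) (n : ℕ) (hd : Summable fun w => d w ^ 2) (ω : Code) :
    AEMeasurable (mult α d (PiNat.cylinder ω n)) ∧
      ∫⁻ y, mult α d (PiNat.cylinder ω n) y = ENNReal.ofReal α * coin (PiNat.cylinder ω n) := by
  rw [coin_cylinder]
  induction n generalizing d ω with
  | zero =>
    rw [PiNat.cylinder_zero, pow_zero, mul_one]
    exact ⟨(measurable_mult_univ hd).aemeasurable, lintegral_mult_univ hα hd⟩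
  | succ n ih =>
    have h := ih (summable_shift hd (ω 0)) (tail ω)
    have e : mult α d (PiNat.cylinder ω (n + 1)) = fun y =>
        mult α (shift (ω 0) d) (PiNat.cylinder (tail ω) n) (expand α d (ω 0) y) := by
      funext y
      rw [cylinder_succ, mult_image_cons hd]
    rw [e, lintegral_expand, h.2, pow_succ]
    exact ⟨aemeasurable_expand α d _ h.1, by ring⟩

theorem mult_eq_count (hd : Summable fun w => d w ^ 2) {B : Set Code} (hB : MeasurableSet B)
    (y : ℝ) : mult α d B y = Measure.count (B ∩ treeSum (inc α d) ⁻¹' {y}) := by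
  rw [Measure.count_apply (hB.inter ((continuous_treeSum_inc hd).measurable
    (measurableSet_singleton y)))]
  rfl

/-- The area formula for the projections of the tree sums: they behave as if they were
differentiable with derivative `α`, whatever the square summable perturbation. -/
theorem lintegral_mult (hα : 0 ≤ α) (hd : Summable fun w => d w ^ 2) {B : Set Code}
    (hB : MeasurableSet B) :
    AEMeasurable (mult α d B) ∧ ∫⁻ y, mult α d B y = ENNReal.ofReal α * coin B := by
  induction B, hB using MeasurableSpace.induction_on_inter borel_eq_generateFrom_cylinders
    isPiSystem_cylinders with
  | empty =>
    have e : mult α d ∅ = fun _ => 0 := by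
      funext y
      simp [mult]
    rw [e]
    simp
  | basic B hB =>
    rcases hB with rfl | ⟨ω, n, rfl⟩
    · have e : mult α d ∅ = fun _ => 0 := by
        funext y
        simp [mult]
      rw [e]
      simp
    · exact mult_cylinder hα n hd ω
  | compl B hB ih =>
    have hsum : ∀ y, mult α d B y + mult α d Bᶜ y = mult α d univ y := fun y => by
      rw [← mult_union disjoint_compl_right, union_compl_self]
    have hfin : ∫⁻ y, mult α d B y ≠ ∞ := by
      rw [ih.2]
      exact ENNReal.mul_ne_top ENNReal.ofReal_ne_top (measure_ne_top _ _)
    have hae : mult α d Bᶜ =ᵐ[volume] fun y => mult α d univ y - mult α d B y := by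
      filter_upwards [ae_lt_top' ih.1 hfin] with y hy
      rw [← hsum, ENNReal.add_sub_cancel_left hy.ne]
    refine ⟨((measurable_mult_univ hd).aemeasurable.sub ih.1).congr hae.symm, ?_⟩
    have h := lintegral_mult_univ hα hd
    simp only [← hsum] at h
    rw [lintegral_add_left' ih.1, ih.2] at h
    have hc : ENNReal.ofReal α * coin B + ENNReal.ofReal α * coin Bᶜ = ENNReal.ofReal α := by
      rw [← mul_add, measure_add_measure_compl hB, measure_univ, mul_one]
    rw [ih.2] at hfin
    exact (ENNReal.add_right_inj hfin).1 (h.trans hc.symm)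
  | iUnion f hf hfm ih =>
    have e : mult α d (⋃ i, f i) = fun y => ∑' i, mult α d (f i) y := by
      funext y
      rw [mult_eq_count hd (.iUnion hfm), iUnion_inter, measure_iUnion]
      · exact tsum_congr fun i => (mult_eq_count hd (hfm i) y).symm
      · exact fun i j hij => (hf hij).mono inter_subset_left inter_subset_left
      · exact fun i => (hfm i).inter ((continuous_treeSum_inc hd).measurable
          (measurableSet_singleton y))
    rw [e, lintegral_tsum fun i => (ih i).1, measure_iUnion hf hfm, ← ENNReal.tsum_mul_left]
    exact ⟨AEMeasurable.tsum fun i => (ih i).1, tsum_congr fun i => (ih i).2⟩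

end Projection

end BinaryTree

/-! ### The limit sets and their Hausdorff measure -/

namespace BinaryTree

open scoped InnerProductSpace Pointwise

/-- An injective labelling of words by rationals on which prepending a digit acts as a permutation
of `ℚ`. -/
def label : List (Fin 2) → ℚ
  | [] => 0
  | a :: w => 3 * label w + (1 + (a : ℕ))

theorem label_injective : Function.Injective label := by
  have hnat : ∀ w, ∃ n : ℕ, label w = n := fun w => by
    induction w with
    | nil => exact ⟨0, by simp [label]⟩
    | cons a w ih =>
      obtain ⟨n, hn⟩ := ih
      exact ⟨3 * n + (1 + (a : ℕ)), by rw [label, hn]; push_cast; ring⟩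
  intro w
  induction w with
  | nil =>
    rintro (_ | ⟨b, v⟩) h
    · rfl
    · obtain ⟨n, hn⟩ := hnat v
      simp only [label, hn] at h
      have h' : 0 = 3 * n + (1 + (b : ℕ)) := by exact_mod_cast h
      omega
  | cons a w ih =>
    rintro (_ | ⟨b, v⟩) h
    · obtain ⟨n, hn⟩ := hnat w
      simp only [label, hn] at h
      have h' : 3 * n + (1 + (a : ℕ)) = 0 := by exact_mod_cast h
      omega
    · obtain ⟨n, hn⟩ := hnat w
      obtain ⟨m, hm⟩ := hnat v
      simp only [label, hn, hm] at h
      have h' : 3 * n + (1 + (a : ℕ)) = 3 * m + (1 + (b : ℕ)) := by exact_mod_cast h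
      have ha := a.2
      have hb := b.2
      have hnm : n = m := by omega
      have hab : a = b := Fin.ext (by omega)
      rw [hab, ih (a₂ := v) (by rw [hn, hm, hnm])]

/-- The permutation of the labels induced by prepending the digit `a`, extended by a fixed point. -/
def labelPerm (a : Fin 2) : Option ℚ ≃ Option ℚ :=
  Equiv.optionCongr ((Equiv.mulLeft₀ (3 : ℚ) three_ne_zero).trans (Equiv.addRight (1 + (a : ℕ))))

theorem labelPerm_none (a : Fin 2) : labelPerm a none = none := rfl

theorem labelPerm_label (a : Fin 2) (w : List (Fin 2)) :
    labelPerm a (some (label w)) = some (label (a :: w)) := rfl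

variable {H : Type*} [NormedAddCommGroup H] [InnerProductSpace ℝ H]

theorem exists_hilbertBasis_option_rat [CompleteSpace H] [TopologicalSpace.SeparableSpace H]
    (hH : ¬ FiniteDimensional ℝ H) : Nonempty (HilbertBasis (Option ℚ) ℝ H) := by
  obtain ⟨w, b, hb⟩ := exists_hilbertBasis ℝ H
  have ho := b.orthonormal
  have hdist : Pairwise fun i j : w => (1 : ℝ) < dist (b i) (b j) := fun i j hij => by
    have h1 : ‖b i - b j‖ ^ 2 = 2 := by
      rw [norm_sub_sq_real, ho.2 hij, ho.1, ho.1]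
      norm_num
    change 1 < dist (b i) (b j)
    rw [dist_eq_norm]
    nlinarith [norm_nonneg (b i - b j)]
  have hc : Countable w := by
    refine Pairwise.countable_of_isOpen_disjoint (s := fun i : w => Metric.ball (b i) (1 / 2))
      (fun i j hij => Metric.ball_disjoint_ball (by linarith [hdist hij]))
      (fun i => Metric.isOpen_ball) fun i => Metric.nonempty_ball.2 (by norm_num)
  have hi : Infinite w := by
    by_contra hfin
    rw [not_infinite_iff_finite] at hfin
    have := Fintype.ofFinite w
    exact hH b.toOrthonormalBasis.toBasis.finiteDimensional_of_finite
  obtain ⟨φ⟩ : Nonempty (w ≃ Option ℚ) := nonempty_equiv_of_countable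
  refine ⟨HilbertBasis.mk (ho.comp φ.symm φ.symm.injective) ?_⟩
  rw [φ.symm.surjective.range_comp, b.dense_span]

/-- The unitary operator that permutes a Hilbert basis. -/
noncomputable def basisPerm {ι : Type*} [CompleteSpace H] (b : HilbertBasis ι ℝ H) (σ : ι ≃ ι) :
    H ≃ₗᵢ[ℝ] H :=
  b.repr.trans (HilbertBasis.mk (b.orthonormal.comp σ σ.injective) (by
    rw [σ.surjective.range_comp, b.dense_span])).repr.symm

theorem basisPerm_apply {ι : Type*} [CompleteSpace H] (b : HilbertBasis ι ℝ H)
    (σ : ι ≃ ι) (i : ι) : basisPerm b σ (b i) = b (σ i) := by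
  classical
  rw [basisPerm, LinearIsometryEquiv.trans_apply, HilbertBasis.repr_self,
    HilbertBasis.repr_symm_single, HilbertBasis.coe_mk]
  rfl

variable (b : HilbertBasis (Option ℚ) ℝ H)

/-- The common direction `κ • b none` plus a private direction for each word. -/
noncomputable def incr (κ : ℝ) (w : List (Fin 2)) : H :=
  κ • b none + (4 : ℝ) • b (some (label w))

/-- The point with code `ω` of the limit set with drift `κ` along `b none`. -/
noncomputable def point (κ : ℝ) : Code → H := treeSum (incr b κ)

theorem norm_incr_le (κ : ℝ) (w : List (Fin 2)) : ‖incr b κ w‖ ≤ |κ| + 4 := by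
  refine (norm_add_le _ _).trans ?_
  rw [norm_smul, norm_smul, b.orthonormal.1, b.orthonormal.1, Real.norm_eq_abs]
  norm_num

theorem norm_point_le (κ : ℝ) (ω : Code) : ‖point b κ ω‖ ≤ |κ| + 4 :=
  norm_treeSum_le (norm_incr_le b κ) ω

/-- The perturbation seen by the functional `v`. -/
noncomputable def coef (v : H) (w : List (Fin 2)) : ℝ := 4 * ⟪v, b (some (label w))⟫_ℝ

theorem summable_coef (v : H) : Summable fun w => coef b v w ^ 2 := by
  have h := (b.orthonormal.comp (fun w => some (label w))
    fun _ _ h => label_injective (Option.some.inj h)).inner_products_summable (x := v)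
  refine (h.mul_left 16).congr fun w => ?_
  rw [coef, real_inner_comm, Real.norm_eq_abs, sq_abs, Function.comp_apply]
  ring

variable [CompleteSpace H]

theorem continuous_point (κ : ℝ) : Continuous (point b κ) := continuous_treeSum (norm_incr_le b κ)

theorem inner_point (κ : ℝ) (v : H) (ω : Code) :
    ⟪v, point b κ ω⟫_ℝ = treeSum (inc (κ * ⟪v, b none⟫_ℝ) (coef b v)) ω := by
  have h := map_treeSum (innerSL ℝ v) (norm_incr_le b κ) ω
  rw [innerSL_apply_apply] at h
  rw [point, h]
  congr 1
  funext w
  rw [innerSL_apply_apply, incr, inner_add_right, inner_smul_right, inner_smul_right]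
  rfl

/-- The unitary part of the generators. -/
noncomputable def rot (a : Fin 2) : H ≃ₗᵢ[ℝ] H := basisPerm b (labelPerm a)

theorem rot_incr (κ : ℝ) (a : Fin 2) (w : List (Fin 2)) :
    rot b a (incr b κ w) = incr b κ (a :: w) := by
  rw [incr, map_add, map_smul, map_smul, rot, basisPerm_apply, basisPerm_apply, labelPerm_none,
    labelPerm_label, incr]

/-- The isometry whose composition with the halving map is the generator `sim`. -/
noncomputable def simIso (κ : ℝ) (a : Fin 2) : H ≃ᵢ H :=
  (rot b a).toIsometryEquiv.trans (IsometryEquiv.addRight (if a = 1 then incr b κ [] else 0))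

/-- The generators `x ↦ (rot x + [a = 1] incr []) / 2` of the iterated function system. -/
noncomputable def sim (κ : ℝ) (a : Fin 2) : H ≃ᵈ H :=
  (simIso b κ a).toDilationEquiv.trans
    (DilationEquiv.smulTorsor (0 : H) (k := (1 / 2 : ℝ)) (by norm_num))

theorem simIso_apply (κ : ℝ) (a : Fin 2) (x : H) :
    simIso b κ a x = rot b a x + if a = 1 then incr b κ [] else 0 := rfl

theorem sim_apply (κ : ℝ) (a : Fin 2) (x : H) :
    sim b κ a x = (1 / 2 : ℝ) • simIso b κ a x := by
  change (1 / 2 : ℝ) • simIso b κ a x +ᵥ (0 : H) = _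
  rw [vadd_eq_add, add_zero]

theorem dist_sim (κ : ℝ) (a : Fin 2) (x y : H) :
    dist (sim b κ a x) (sim b κ a y) = 1 / 2 * dist x y := by
  rw [sim_apply, sim_apply, dist_smul₀, (simIso b κ a).dist_eq, Real.norm_of_nonneg (by norm_num)]

theorem ratio_sim_lt_one (κ : ℝ) (a : Fin 2) : Dilation.ratio (sim b κ a) < 1 := by
  have hne : dist (b none) 0 ≠ 0 := by
    rw [dist_zero_right, b.orthonormal.1]
    norm_num
  have h := dist_sim b κ a (b none) 0
  rw [Dilation.dist_eq (sim b κ a)] at h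
  have h' := mul_right_cancel₀ hne h
  rw [← NNReal.coe_lt_coe, h']
  norm_num

theorem sim_point (κ : ℝ) (a : Fin 2) (ω : Code) :
    sim b κ a (point b κ ω) = point b κ (cons a ω) := by
  have h := map_treeSum ((rot b a).toContinuousLinearEquiv : H →L[ℝ] H) (norm_incr_le b κ) ω
  rw [sim_apply, simIso_apply, point, treeSum_cons (norm_incr_le b κ), add_comm]
  congr 2
  refine h.trans ?_
  congr 1
  funext w
  exact rot_incr b κ a w

theorem dist_ifsWord (κ : ℝ) (ω : Code) (n : ℕ) (x y : H) :
    dist (ifsWord (fun a => ⇑(sim b κ a)) ω n x) (ifsWord (fun a => ⇑(sim b κ a)) ω n y) =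
      (1 / 2) ^ n * dist x y := by
  induction n generalizing x y with
  | zero => simp [ifsWord]
  | succ n ih =>
    simp only [ifsWord, Function.comp_apply]
    rw [ih, dist_sim]
    ring

theorem ifsWord_congr {X E : Type*} (u : E → X → X) {ω η : ℕ → E} (n : ℕ)
    (h : ∀ i < n, η i = ω i) : ifsWord u η n = ifsWord u ω n := by
  induction n with
  | zero => rfl
  | succ n ih => rw [ifsWord, ifsWord, ih fun i hi => h i (by omega), h n (by omega)]

theorem ifsWord_point (κ : ℝ) (ω : Code) (n : ℕ) :
    ifsWord (fun a => ⇑(sim b κ a)) ω n (point b κ (tail^[n] ω)) = point b κ ω := by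
  induction n with
  | zero => rfl
  | succ n ih =>
    have h : sim b κ (ω n) (point b κ (tail^[n + 1] ω)) = point b κ (tail^[n] ω) := by
      have h0 : (tail^[n] ω) 0 = ω n := by rw [tail_iterate_apply, add_zero]
      rw [sim_point, ← tail_tail_iterate, ← h0, cons_tail]
    rw [ifsWord, Function.comp_apply, h, ih]

theorem ifsLimitSet_sim (κ : ℝ) :
    ifsLimitSet (fun a => ⇑(sim b κ a)) = range (point b κ) := by
  have hlim : ∀ (ω : Code) (p : H),
      Tendsto (fun n => ifsWord (fun a => ⇑(sim b κ a)) ω n p) atTop (𝓝 (point b κ ω)) := by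
    intro ω p
    rw [tendsto_iff_dist_tendsto_zero]
    have h0 : Tendsto (fun n : ℕ => (1 / 2 : ℝ) ^ n * (‖p‖ + (|κ| + 4))) atTop (𝓝 0) := by
      simpa using (tendsto_pow_atTop_nhds_zero_of_lt_one (r := (1 / 2 : ℝ)) (by norm_num)
        (by norm_num)).mul_const (‖p‖ + (|κ| + 4))
    refine squeeze_zero (fun _ => dist_nonneg) (fun n => ?_) h0
    rw [← ifsWord_point b κ ω n, dist_ifsWord, dist_eq_norm]
    gcongr
    exact (norm_sub_le _ _).trans (add_le_add_right (norm_point_le b κ _) _)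
  ext x
  constructor
  · rintro ⟨ω, hω⟩
    exact ⟨ω, tendsto_nhds_unique (hlim ω 0) (hω 0)⟩
  · rintro ⟨ω, rfl⟩
    exact ⟨ω, hlim ω⟩

/-- The private direction of the empty word reads off the first digit. -/
theorem inner_root_point (κ : ℝ) (ω : Code) :
    ⟪b (some (label [])), point b κ ω⟫_ℝ = if ω 0 = 1 then 2 else 0 := by
  have h : inc (κ * ⟪b (some (label [])), b none⟫_ℝ) (coef b (b (some (label [])))) =
      fun w => if w = [] then 4 else 0 := by
    funext w
    rw [inc, coef, b.orthonormal.2 (by simp), mul_zero, zero_add]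
    split_ifs with hw
    · rw [hw, real_inner_self_eq_norm_sq, b.orthonormal.1]
      norm_num
    · rw [b.orthonormal.2 fun h => hw (label_injective (Option.some.inj h)).symm, mul_zero]
  have hb : ∀ w : List (Fin 2), ‖(if w = [] then 4 else 0 : ℝ)‖ ≤ 4 := fun w => by
    split_ifs <;> norm_num
  rw [inner_point, h, treeSum_eq_tail hb]
  have h0 : treeSum (shift (ω 0) fun w : List (Fin 2) => if w = [] then (4 : ℝ) else 0)
      (tail ω) = 0 := by
    simp [treeSum, shift]
  rw [h0]
  by_cases hω : ω 0 = 1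
  · rw [if_pos hω, if_pos hω, if_pos rfl]
    norm_num
  · rw [if_neg hω, if_neg hω]
    norm_num

theorem dist_point_ge_two {κ : ℝ} {ω η : Code} (h : ω 0 ≠ η 0) :
    2 ≤ dist (point b κ ω) (point b κ η) := by
  have h1 := abs_real_inner_le_norm (b (some (label []))) (point b κ ω - point b κ η)
  rw [b.orthonormal.1, one_mul, inner_sub_right, inner_root_point, inner_root_point] at h1
  rw [dist_eq_norm]
  refine le_trans ?_ h1
  generalize ω 0 = a at h ⊢
  generalize η 0 = c at h ⊢
  fin_cases a <;> fin_cases c <;> simp at h ⊢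

/-- The limit set carries an ultrametric up to bounded factors. -/
theorem dist_point_ge {κ : ℝ} {ω η : Code} (h : ω ≠ η) :
    2 * (1 / 2) ^ PiNat.firstDiff ω η ≤ dist (point b κ ω) (point b κ η) := by
  set n := PiNat.firstDiff ω η with hn
  rw [← ifsWord_point b κ ω n, ← ifsWord_point b κ η n, ifsWord_congr (ω := ω) (η := η) _ n
    fun i hi => (PiNat.apply_eq_of_lt_firstDiff hi).symm, dist_ifsWord, mul_comm]
  gcongr
  refine dist_point_ge_two b ?_
  rw [tail_iterate_apply, tail_iterate_apply, add_zero]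
  exact PiNat.apply_firstDiff_ne h

theorem dist_point_le {κ : ℝ} {ω η : Code} {n : ℕ} (h : η ∈ PiNat.cylinder ω n) :
    dist (point b κ η) (point b κ ω) ≤ 2 * (|κ| + 4) * (1 / 2) ^ n := by
  rw [dist_eq_norm]
  exact norm_treeSum_sub_le n (norm_incr_le b κ) h

theorem point_injective (κ : ℝ) : Function.Injective (point b κ) := by
  intro ω η h
  by_contra hne
  have := dist_point_ge b (κ := κ) hne
  rw [h, dist_self] at this
  have : (0 : ℝ) < 2 * (1 / 2) ^ PiNat.firstDiff ω η := by positivity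
  linarith

theorem isSeparatedSimilarityLimitSet_range_point (κ : ℝ) :
    IsSeparatedSimilarityLimitSet (range (point b κ)) := by
  refine ⟨2, sim b κ, ratio_sim_lt_one b κ, ifsLimitSet_sim b κ, fun a c hac => ?_⟩
  change Disjoint (sim b κ a '' _) (sim b κ c '' _)
  rw [Set.disjoint_left]
  rintro _ ⟨_, ⟨ω, rfl⟩, rfl⟩ ⟨_, ⟨η, rfl⟩, h⟩
  rw [sim_point, sim_point] at h
  exact hac (congrFun (point_injective b κ h) 0).symm

section Hausdorff

variable [MeasurableSpace H] [BorelSpace H]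

omit [MeasurableSpace H] [BorelSpace H] in
theorem isClosedEmbedding_point (κ : ℝ) : IsClosedEmbedding (point b κ) :=
  (continuous_point b κ).isClosedEmbedding (point_injective b κ)

theorem measurableEmbedding_point (κ : ℝ) : MeasurableEmbedding (point b κ) :=
  (isClosedEmbedding_point b κ).measurableEmbedding

/-- The natural self-similar probability measure on the limit set. -/
noncomputable def natMeasure (κ : ℝ) : Measure H := coin.map (point b κ)

instance (κ : ℝ) : IsProbabilityMeasure (natMeasure b κ) :=
  Measure.isProbabilityMeasure_map (continuous_point b κ).aemeasurable

theorem hausdorffMeasure_image_sim (κ : ℝ) (a : Fin 2) (s : Set H) :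
    μH[1] (sim b κ a '' s) = 2⁻¹ * μH[1] s := by
  have h : sim b κ a '' s = (1 / 2 : ℝ) • (simIso b κ a '' s) := by
    rw [← image_smul, image_image]
    exact image_congr fun x _ => sim_apply b κ a x
  have hn : ‖(1 / 2 : ℝ)‖₊ = 2⁻¹ := by
    ext
    norm_num
  rw [h, Measure.hausdorffMeasure_smul₀ zero_le_one (by norm_num),
    (simIso b κ a).hausdorffMeasure_image, NNReal.rpow_one, hn, ENNReal.smul_def, smul_eq_mul,
    ENNReal.coe_inv two_ne_zero]
  rfl

theorem hausdorffMeasure_image_cylinder (κ : ℝ) (ω : Code) (n : ℕ) :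
    μH[1] (point b κ '' PiNat.cylinder ω n) = 2⁻¹ ^ n * μH[1] (range (point b κ)) := by
  induction n generalizing ω with
  | zero => rw [PiNat.cylinder_zero, image_univ, pow_zero, one_mul]
  | succ n ih =>
    have h : point b κ '' PiNat.cylinder ω (n + 1) =
        sim b κ (ω 0) '' (point b κ '' PiNat.cylinder (tail ω) n) := by
      rw [cylinder_succ, image_image, image_image]
      exact image_congr fun η _ => (sim_point b κ (ω 0) η).symm
    rw [h, hausdorffMeasure_image_sim, ih, pow_succ']
    ring

theorem hausdorffMeasure_range_lt_top (κ : ℝ) : μH[1] (range (point b κ)) < ∞ := by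
  set D : ℝ := 2 * (|κ| + 4) with hD
  have hD0 : 0 ≤ D := by positivity
  let ext : ∀ n : ℕ, (Fin n → Fin 2) → Code := fun n w i => if h : i < n then w ⟨i, h⟩ else 0
  have hr : Tendsto (fun n : ℕ => ENNReal.ofReal (D * (1 / 2 : ℝ) ^ n)) atTop (𝓝 0) := by
    rw [← ENNReal.ofReal_zero]
    refine ENNReal.tendsto_ofReal ?_
    simpa using (tendsto_pow_atTop_nhds_zero_of_lt_one (r := (1 / 2 : ℝ)) (by norm_num)
      (by norm_num)).const_mul D
  have hdiam : ∀ n (i : Fin n → Fin 2),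
      Metric.ediam (point b κ '' PiNat.cylinder (ext n i) n) ≤
        ENNReal.ofReal (D * (1 / 2 : ℝ) ^ n) := by
    intro n i
    refine Metric.ediam_le ?_
    rintro _ ⟨ω, hω, rfl⟩ _ ⟨η, hη, rfl⟩
    rw [edist_dist]
    refine ENNReal.ofReal_le_ofReal (dist_point_le b ?_)
    rw [PiNat.mem_cylinder_iff_eq.1 hη]
    exact hω
  have hcover : ∀ n, range (point b κ) ⊆ ⋃ i, point b κ '' PiNat.cylinder (ext n i) n := by
    rintro n _ ⟨ω, rfl⟩
    refine mem_iUnion.2 ⟨fun i => ω i, mem_image_of_mem _ ?_⟩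
    rw [PiNat.mem_cylinder_iff]
    intro i hi
    simp [ext, hi]
  refine (Measure.hausdorffMeasure_le_liminf_sum 1 (range (point b κ)) _ hr
    (fun n i => point b κ '' PiNat.cylinder (ext n i) n) (Eventually.of_forall hdiam)
    (Eventually.of_forall hcover)).trans_lt ?_
  refine lt_of_le_of_lt (b := ENNReal.ofReal D) ?_ ENNReal.ofReal_lt_top
  refine (liminf_le_liminf (v := fun _ : ℕ => ENNReal.ofReal D)
    (Eventually.of_forall fun n => ?_)).trans (liminf_const _).le
  calc ∑ i, Metric.ediam (point b κ '' PiNat.cylinder (ext n i) n) ^ (1 : ℝ)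
      ≤ ∑ _i : Fin n → Fin 2, ENNReal.ofReal (D * (1 / 2 : ℝ) ^ n) :=
        Finset.sum_le_sum fun i _ => by rw [ENNReal.rpow_one]; exact hdiam n i
    _ = ENNReal.ofReal ((2 : ℝ) ^ n * (D * (1 / 2 : ℝ) ^ n)) := by
        rw [Finset.sum_const, Finset.card_univ, Fintype.card_fun, Fintype.card_fin,
          Fintype.card_fin, nsmul_eq_mul, ENNReal.ofReal_mul (p := 2 ^ n) (by positivity)]
        congr 1
        rw [ENNReal.ofReal_pow (by norm_num)]
        norm_num
    _ = ENNReal.ofReal D := by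
        congr 1
        rw [mul_left_comm, ← mul_pow]
        norm_num

theorem coin_singleton (ω : Code) : coin {ω} = 0 := by
  have h : Tendsto (fun n : ℕ => (2⁻¹ : ℝ≥0∞) ^ n) atTop (𝓝 0) :=
    ENNReal.tendsto_pow_atTop_nhds_zero_of_lt_one (by norm_num)
  refine le_antisymm (ge_of_tendsto' h fun n => ?_) zero_le
  rw [← coin_cylinder ω n]
  exact measure_mono (singleton_subset_iff.2 (PiNat.self_mem_cylinder ω n))

omit [MeasurableSpace H] [BorelSpace H] in
/-- A set of codes of positive measure contains two codes at distance comparable to its measure. -/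
theorem two_mul_coin_le_ediam (κ : ℝ) (B : Set Code) :
    2 * coin B ≤ Metric.ediam (point b κ '' B) := by
  classical
  rcases B.subsingleton_or_nontrivial with hB | hB
  · have : coin B = 0 := by
      rcases hB.eq_empty_or_singleton with rfl | ⟨ω, rfl⟩
      · simp
      · exact coin_singleton ω
    simp [this]
  have hex : ∃ n, ∃ ω ∈ B, ∃ η ∈ B, ω ≠ η ∧ PiNat.firstDiff ω η = n := by
    obtain ⟨ω, hω, η, hη, hne⟩ := hB
    exact ⟨_, ω, hω, η, hη, hne, rfl⟩
  obtain ⟨ω, hω, η, hη, hne, hn⟩ := Nat.find_spec hex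
  set n := Nat.find hex with hn'
  have hsub : B ⊆ PiNat.cylinder ω n := by
    intro ζ hζ
    by_cases h : ζ = ω
    · rw [h]
      exact PiNat.self_mem_cylinder ω n
    · rw [PiNat.mem_cylinder_iff_le_firstDiff h]
      exact Nat.find_min' hex ⟨ζ, hζ, ω, hω, h, rfl⟩
  calc 2 * coin B ≤ 2 * 2⁻¹ ^ n := by
        rw [← coin_cylinder ω n]
        exact mul_le_mul_right (measure_mono hsub) _
    _ = ENNReal.ofReal (2 * (1 / 2) ^ n) := by
        rw [ENNReal.ofReal_mul (by norm_num), ENNReal.ofReal_pow (by norm_num), one_div,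
          ENNReal.ofReal_inv_of_pos (by norm_num)]
        norm_num
    _ ≤ edist (point b κ ω) (point b κ η) := by
        rw [edist_dist, ← hn]
        exact ENNReal.ofReal_le_ofReal (dist_point_ge b hne)
    _ ≤ _ := Metric.edist_le_ediam_of_mem (mem_image_of_mem _ hω) (mem_image_of_mem _ hη)

theorem two_smul_natMeasure_le (κ : ℝ) : (2 : ℝ≥0∞) • natMeasure b κ ≤ μH[1] := by
  refine Measure.le_hausdorffMeasure 1 _ 1 one_pos fun s _ => ?_
  rw [ENNReal.rpow_one, Measure.smul_apply, smul_eq_mul]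
  calc 2 * natMeasure b κ s ≤ 2 * natMeasure b κ (closure s) :=
        mul_le_mul_right (measure_mono subset_closure) _
    _ = 2 * coin (point b κ ⁻¹' closure s) := by
        rw [natMeasure, (measurableEmbedding_point b κ).map_apply]
    _ ≤ Metric.ediam (point b κ '' (point b κ ⁻¹' closure s)) := two_mul_coin_le_ediam b κ _
    _ ≤ Metric.ediam (closure s) := Metric.ediam_mono (image_preimage_subset _ _)
    _ = Metric.ediam s := Metric.ediam_closure s

theorem natMeasure_range (κ : ℝ) : natMeasure b κ (range (point b κ)) = 1 := by
  rw [natMeasure, (measurableEmbedding_point b κ).map_apply, preimage_range, measure_univ]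

theorem natMeasure_compl_range (κ : ℝ) : natMeasure b κ (range (point b κ))ᶜ = 0 := by
  rw [natMeasure, (measurableEmbedding_point b κ).map_apply, preimage_compl, preimage_range,
    compl_univ, measure_empty]

theorem two_le_hausdorffMeasure_range (κ : ℝ) : 2 ≤ μH[1] (range (point b κ)) := by
  have h := two_smul_natMeasure_le b κ (range (point b κ))
  rwa [Measure.smul_apply, natMeasure_range, smul_eq_mul, mul_one] at h

theorem hausdorffMeasure_restrict_range (κ : ℝ) :
    (μH[1] : Measure H).restrict (range (point b κ)) =
      μH[1] (range (point b κ)) • natMeasure b κ := by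
  have he := measurableEmbedding_point b κ
  set m : Measure Code := (μH[1] : Measure H).comap (point b κ) with hm
  have hu : m univ = μH[1] (range (point b κ)) := by rw [hm, he.comap_apply, image_univ]
  have : IsFiniteMeasure m := ⟨by rw [hu]; exact hausdorffMeasure_range_lt_top b κ⟩
  have h := eq_smul_coin (m := m) fun ω n => by
    rw [hu, hm, he.comap_apply, hausdorffMeasure_image_cylinder]
  rw [hu] at h
  rw [← he.map_comap, ← hm, h, Measure.map_smul, natMeasure]

end Hausdorff

end BinaryTree

/-! ### Unrectifiability -/

namespace BinaryTree

/-- If the distance of any two values of `F` on `s` is controlled by the length of the complement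
of `s` between the two arguments, then `F '' s` has no length: at almost every point of `s` that
complement has density zero. -/
theorem hausdorffMeasure_image_eq_zero_of_dist_le_gaps {X : Type*} [MetricSpace X]
    [MeasurableSpace X] [BorelSpace X] {F : ℝ → X} {s : Set ℝ} {C : ℝ} (hs : MeasurableSet s)
    (hC : 0 ≤ C)
    (hF : ∀ x ∈ s, ∀ y ∈ s, x < y → dist (F x) (F y) ≤ C * volume.real (Icc x y \ s)) :
    μH[1] (F '' s) = 0 := by
  set g : ℝ → ℝ := sᶜ.indicator 1 with hg
  have hgi : LocallyIntegrable g volume :=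
    (locallyIntegrable_const (1 : ℝ)).indicator hs.compl
  have hii : ∀ a b, IntervalIntegrable g volume a b := fun a b =>
    intervalIntegrable_iff.mpr
      ((hgi.integrableOn_isCompact isCompact_uIcc).mono_set uIoc_subset_uIcc)
  -- `G` measures the complement of `s`; it has derivative zero almost everywhere on `s`.
  set G : ℝ → ℝ := fun x => ∫ t in (0 : ℝ)..x, g t with hG
  have hsub : ∀ x y, x ≤ y → G y - G x = volume.real (Icc x y \ s) := fun x y hxy => by
    rw [hG]
    simp only
    rw [intervalIntegral.integral_interval_sub_left (hii _ _) (hii _ _),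
      intervalIntegral.integral_of_le hxy, hg, integral_indicator_one hs.compl,
      Measure.restrict_congr_set Ioc_ae_eq_Icc, measureReal_restrict_apply hs.compl, sdiff_eq,
      inter_comm]
  have hdist : ∀ x ∈ s, ∀ y ∈ s, dist (F x) (F y) ≤ C * dist (G x) (G y) := by
    have key : ∀ x ∈ s, ∀ y ∈ s, x < y → dist (F x) (F y) ≤ C * dist (G x) (G y) := by
      intro x hx y hy hxy
      refine (hF x hx y hy hxy).trans ?_
      rw [← hsub x y hxy.le, dist_comm, Real.dist_eq]
      exact mul_le_mul_of_nonneg_left (le_abs_self _) hC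
    intro x hx y hy
    rcases lt_trichotomy x y with h | rfl | h
    · exact key x hx y hy h
    · simp
    · rw [dist_comm (F x), dist_comm (G x)]
      exact key y hy x hx h
  have hGlip : LipschitzWith 1 G := by
    have key : ∀ x y, x ≤ y → dist (G x) (G y) ≤ dist x y := by
      intro x y hxy
      rw [dist_comm, Real.dist_eq, hsub x y hxy, abs_of_nonneg measureReal_nonneg, dist_comm,
        Real.dist_eq, abs_of_nonneg (sub_nonneg.2 hxy), ← Real.volume_real_Icc_of_le hxy]
      exact measureReal_mono sdiff_subset measure_Icc_lt_top.ne
    refine LipschitzWith.of_dist_le_mul fun x y => ?_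
    rw [NNReal.coe_one, one_mul]
    rcases le_total x y with h | h
    · exact key x y h
    · rw [dist_comm (G x), dist_comm x]
      exact key y x h
  have hnull : volume (G '' s) = 0 := by
    set N : Set ℝ := {x | ¬ ∀ c, HasDerivAt (fun x => ∫ t in c..x, g t) (g x) x} with hN
    have hN0 : volume N = 0 := LocallyIntegrable.ae_hasDerivAt_integral hgi
    have h1 : volume (G '' N) = 0 := by
      have h := hGlip.hausdorffMeasure_image_le zero_le_one N
      rw [hausdorffMeasure_real, hN0, mul_zero] at h
      exact le_antisymm h zero_le
    have h2 : volume (G '' (s \ N)) = 0 := by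
      refine addHaar_image_eq_zero_of_det_fderivWithin_eq_zero (f' := fun _ => 0) volume
        (fun x hx => ?_) fun x _ => by simp
      have hd : HasDerivAt G (g x) x := by
        have := hx.2
        rw [hN, mem_ofPred_eq, not_not] at this
        exact this 0
      have hgx : g x = 0 := indicator_of_notMem (notMem_compl_iff.2 hx.1) _
      rw [hgx] at hd
      have := hd.hasFDerivAt.hasFDerivWithinAt (s := s \ N)
      simpa using this
    refine measure_mono_null (image_mono fun x hx => ?_)
      (by rw [image_union]; exact measure_union_null h1 h2 : volume (G '' (N ∪ s \ N)) = 0)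
    by_cases h : x ∈ N
    · exact Or.inl h
    · exact Or.inr ⟨hx, h⟩
  -- `F` factors on `s` through `G` by a Lipschitz map.
  set ψ : ℝ → ℝ := Function.invFunOn G s with hψ
  have hψs : ∀ z ∈ G '' s, ψ z ∈ s ∧ G (ψ z) = z := fun z hz =>
    ⟨Function.invFunOn_mem hz, Function.invFunOn_eq hz⟩
  have hLip : LipschitzOnWith C.toNNReal (F ∘ ψ) (G '' s) := by
    refine LipschitzOnWith.of_dist_le_mul fun z hz w hw => ?_
    have h := hdist _ (hψs z hz).1 _ (hψs w hw).1
    rwa [(hψs z hz).2, (hψs w hw).2, ← Real.coe_toNNReal C hC] at h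
  have himg : F '' s ⊆ (F ∘ ψ) '' (G '' s) := by
    rintro _ ⟨x, hx, rfl⟩
    have hz := hψs (G x) (mem_image_of_mem G hx)
    refine ⟨G x, mem_image_of_mem G hx, ?_⟩
    have h := hdist _ hz.1 _ hx
    rw [hz.2, dist_self, mul_zero] at h
    exact dist_le_zero.1 h
  refine measure_mono_null himg (le_antisymm ?_ zero_le)
  refine (hLip.hausdorffMeasure_image_le zero_le_one).trans ?_
  rw [hausdorffMeasure_real, hnull, mul_zero]

variable {H : Type*} [NormedAddCommGroup H] [InnerProductSpace ℝ H] [CompleteSpace H]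
  (b : HilbertBasis (Option ℚ) ℝ H)

/-- A Lipschitz curve can pass from one piece of the limit set to another only by spending a
proportional amount of parameter outside of the limit set. -/
theorem dist_le_gap {κ : ℝ} {F : ℝ → H} {s : Set ℝ} {K : NNReal} (hK : 0 < K)
    (hF : LipschitzOnWith K F s) (hs : ∀ x ∈ s, F x ∈ range (point b κ)) {x y : ℝ} (hx : x ∈ s)
    (hy : y ∈ s) (hxy : x < y) :
    dist (F x) (F y) ≤ (|κ| + 4) * K * volume.real (Icc x y \ s) := by
  rcases eq_or_ne (F x) (F y) with h | hne
  · rw [h, dist_self]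
    positivity
  choose! φ hφ using hs
  have hφne : φ x ≠ φ y := fun h => hne (by rw [← hφ x hx, ← hφ y hy, h])
  set n := PiNat.firstDiff (φ x) (φ y) with hn
  have hK' : (0 : ℝ) < K := hK
  set δ : ℝ := 2 * (1 / 2) ^ n / K with hδ
  have hδ0 : 0 < δ := by positivity
  have hsep : ∀ k ∈ s, ∀ l ∈ s, (∃ i ≤ n, φ k i ≠ φ l i) → δ ≤ |k - l| := by
    rintro k hk l hl ⟨i, hi, hil⟩
    have hkl : φ k ≠ φ l := fun h => hil (by rw [h])
    have hle : PiNat.firstDiff (φ k) (φ l) ≤ n := by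
      by_contra hlt
      exact hil (PiNat.apply_eq_of_lt_firstDiff (by omega))
    have h1 := dist_point_ge b (κ := κ) hkl
    have h2 := hF.dist_le_mul k hk l hl
    rw [hφ k hk, hφ l hl] at h1
    have h3 : (1 / 2 : ℝ) ^ n ≤ (1 / 2) ^ PiNat.firstDiff (φ k) (φ l) :=
      pow_le_pow_of_le_one (by norm_num) (by norm_num) hle
    rw [hδ, div_le_iff₀ hK', ← Real.dist_eq]
    linarith
  -- The last point `z` before the curve leaves the piece of generation `n + 1` of `F x`.
  set A : Set ℝ := {k | k ∈ s ∧ k ≤ y ∧ ∀ i ≤ n, φ k i = φ x i} with hA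
  have hxA : x ∈ A := ⟨hx, hxy.le, fun _ _ => rfl⟩
  have hbdd : BddAbove A := ⟨y, fun k hk => hk.2.1⟩
  set z := sSup A with hz
  have hxz : x ≤ z := le_csSup hbdd hxA
  have hleave : ∀ k ∈ s, k ≤ y → k ∉ A → z ≤ k → z + δ ≤ k := by
    intro k hk hky hkA hzk
    have : z ≤ k - δ := by
      refine csSup_le ⟨x, hxA⟩ fun a ha => ?_
      have hex : ∃ i ≤ n, φ k i ≠ φ a i := by
        by_contra! hall
        exact hkA ⟨hk, hky, fun i hi => (hall i hi).trans (ha.2.2 i hi)⟩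
      have h := hsep k hk a ha.1 hex
      rw [abs_of_nonneg (by linarith [le_csSup hbdd ha])] at h
      linarith
    linarith
  have hyA : y ∉ A := fun h =>
    PiNat.apply_firstDiff_ne hφne (h.2.2 _ le_rfl).symm
  have hzy : z + δ ≤ y := hleave y hy le_rfl hyA (csSup_le ⟨x, hxA⟩ fun a ha => ha.2.1)
  have hsubset : Ioo z (z + δ) ⊆ Icc x y \ s := by
    rintro k ⟨hk1, hk2⟩
    refine ⟨⟨by linarith, by linarith⟩, fun hk => ?_⟩
    have := hleave k hk (by linarith) (fun h => absurd (le_csSup hbdd h) (by linarith)) hk1.le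
    linarith
  have hvol : δ ≤ volume.real (Icc x y \ s) := by
    have h := measureReal_mono hsubset
      ((measure_mono sdiff_subset).trans_lt (measure_Icc_lt_top (μ := (volume : Measure ℝ)))).ne
    rwa [Real.volume_real_Ioo_of_le (by linarith), add_sub_cancel_left] at h
  calc dist (F x) (F y) = dist (point b κ (φ x)) (point b κ (φ y)) := by rw [hφ x hx, hφ y hy]
    _ ≤ 2 * (|κ| + 4) * (1 / 2) ^ n := dist_point_le b (PiNat.mem_cylinder_firstDiff _ _)
    _ = (|κ| + 4) * K * δ := by
      rw [hδ]
      field_simp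
    _ ≤ _ := by gcongr

variable [MeasurableSpace H] [BorelSpace H]

theorem hausdorffMeasure_curve_inter_range (κ : ℝ) {F : ℝ → H} {K : NNReal}
    (hF : LipschitzOnWith K F (Icc 0 1)) :
    μH[1] (F '' Icc 0 1 ∩ range (point b κ)) = 0 := by
  have hF' : LipschitzOnWith (K + 1) F (Icc 0 1) := hF.weaken (by simp)
  set s : Set ℝ := Icc 0 1 ∩ F ⁻¹' range (point b κ) with hs
  have hclosed : IsClosed s :=
    hF.continuousOn.preimage_isClosed_of_isClosed isClosed_Icc
      (isClosedEmbedding_point b κ).isClosed_range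
  have h := hausdorffMeasure_image_eq_zero_of_dist_le_gaps (F := F) (s := s)
    (C := (|κ| + 4) * (K + 1 : NNReal)) hclosed.measurableSet (by positivity)
    fun x hx y hy hxy => dist_le_gap b (by positivity) (hF'.mono inter_subset_left)
      (fun x hx => hx.2) hx hy hxy
  rwa [hs, image_inter_preimage] at h

theorem not_isRectifiable_range_point (κ : ℝ) : ¬ IsRectifiable 1 (range (point b κ)) := by
  rintro ⟨f, hf, h0⟩
  rw [Nat.cast_one] at h0
  set Q : Set (EuclideanSpace ℝ (Fin 1)) := {x | ∀ j, x j ∈ Icc (0 : ℝ) 1} with hQ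
  set ι : ℝ → EuclideanSpace ℝ (Fin 1) := fun t => WithLp.toLp 2 fun _ => t with hι
  have hιQ : ι '' Icc 0 1 = Q := by
    ext x
    constructor
    · rintro ⟨t, ht, rfl⟩
      exact fun _ => ht
    · intro hx
      refine ⟨x 0, hx 0, ?_⟩
      ext j
      rw [Subsingleton.elim j 0]
  have hιlip : LipschitzWith 1 ι := LipschitzWith.of_dist_le_mul fun x y => by
    rw [EuclideanSpace.dist_eq, Fin.sum_univ_one, Real.sqrt_sq dist_nonneg]
    simp [hι]
  have hi : ∀ i, μH[1] (f i '' Q ∩ range (point b κ)) = 0 := fun i => by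
    obtain ⟨K, hK⟩ := hf i
    have hcomp : LipschitzOnWith (K * 1) (f i ∘ ι) (Icc 0 1) :=
      hK.comp (hιlip.lipschitzOnWith) (by rw [← hιQ]; exact mapsTo_image ι _)
    have := hausdorffMeasure_curve_inter_range b κ hcomp
    rwa [image_comp, hιQ] at this
  have hle : μH[1] (range (point b κ)) = 0 := by
    refine measure_mono_null (fun x hx => ?_) (measure_union_null h0 (measure_iUnion_null hi))
    by_cases h : x ∈ ⋃ i, f i '' Q
    · obtain ⟨i, hi⟩ := mem_iUnion.1 h
      exact Or.inr (mem_iUnion.2 ⟨i, hi, hx⟩)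
    · exact Or.inl ⟨hx, h⟩
  have := two_le_hausdorffMeasure_range b κ
  rw [hle] at this
  simp at this

end BinaryTree

/-! ### Projections onto lines -/

namespace BinaryTree

open scoped InnerProductSpace

theorem metricDet_eq_norm_of_finrank_eq_one {E F : Type*} [NormedAddCommGroup E]
    [InnerProductSpace ℝ E] [FiniteDimensional ℝ E] [NormedAddCommGroup F] [InnerProductSpace ℝ F]
    (h : Module.finrank ℝ E = 1) (L : E →ₗ[ℝ] F) {x : E} (hx : ‖x‖ = 1) :
    metricDet L = ‖L x‖ := by
  set b := stdOrthonormalBasis ℝ E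
  let i : Fin (Module.finrank ℝ E) := ⟨0, by omega⟩
  have hne : b i ≠ 0 := b.orthonormal.ne_zero i
  obtain ⟨c, hc⟩ := (finrank_eq_one_iff_of_nonzero' (b i) hne).1 h x
  have hc1 : ‖c‖ = 1 := by
    rw [← hx, ← hc, norm_smul, b.orthonormal.1, mul_one]
  rw [metricDet, Matrix.det_eq_elem_of_card_eq_one (by rw [Fintype.card_fin, h]) i,
    Matrix.gram_apply, real_inner_self_eq_norm_sq, Real.sqrt_sq (norm_nonneg _), ← hc, map_smul,
    norm_smul, hc1, one_mul]

variable {H : Type*} [NormedAddCommGroup H] [InnerProductSpace ℝ H]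

/-- The line spanned by a unit vector. -/
def line (v : H) (hv : ‖v‖ = 1) : Grass 1 H :=
  ⟨ℝ ∙ v, inferInstance, finrank_span_singleton (norm_ne_zero_iff.1 (by rw [hv]; exact one_ne_zero))⟩

/-- Every line is spanned by a unit vector that makes a non-obtuse angle with a given vector. -/
theorem exists_eq_line (V : Grass 1 H) (u : H) :
    ∃ (v : H) (hv : ‖v‖ = 1), V = line v hv ∧ 0 ≤ ⟪v, u⟫_ℝ := by
  obtain ⟨W, hW, hW1⟩ := V
  obtain ⟨⟨w, hwW⟩, hw0, hw⟩ := finrank_eq_one_iff'.1 hW1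
  have hw0' : w ≠ 0 := fun h => hw0 (Subtype.ext h)
  have hspan : W = ℝ ∙ w := by
    refine le_antisymm (fun x hx => ?_) ((Submodule.span_singleton_le_iff_mem w W).2 hwW)
    obtain ⟨c, hc⟩ := hw ⟨x, hx⟩
    exact Submodule.mem_span_singleton.2 ⟨c, congrArg Subtype.val hc⟩
  have hunit : ‖(‖w‖⁻¹ : ℝ) • w‖ = 1 := by
    rw [norm_smul, norm_inv, norm_norm, inv_mul_cancel₀ (norm_ne_zero_iff.2 hw0')]
  have hs : W = ℝ ∙ ((‖w‖⁻¹ : ℝ) • w) := by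
    rw [hspan, Submodule.span_singleton_smul_eq (IsUnit.mk0 _ (inv_ne_zero
      (norm_ne_zero_iff.2 hw0')))]
  set v := (‖w‖⁻¹ : ℝ) • w
  rcases le_total 0 ⟪v, u⟫_ℝ with h | h
  · exact ⟨v, hunit, Subtype.ext hs, h⟩
  · refine ⟨-v, by rw [norm_neg, hunit], Subtype.ext ?_, by rw [inner_neg_left]; linarith⟩
    change W = ℝ ∙ (-v)
    rw [hs, ← Submodule.span_neg, neg_singleton]

theorem starProjection_line {v : H} (hv : ‖v‖ = 1) (x : H) :
    (line v hv).space.starProjection x = ⟪v, x⟫_ℝ • v :=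
  Submodule.starProjection_unit_singleton ℝ hv x

theorem projDet_line {v t : H} (hv : ‖v‖ = 1) (ht : ‖t‖ = 1) :
    projDet (line v hv) (line t ht) = |⟪v, t⟫_ℝ| := by
  have hmem : t ∈ (line t ht).space := Submodule.mem_span_singleton_self t
  have h := metricDet_eq_norm_of_finrank_eq_one (E := (line t ht).space) (line t ht).2.2
    ((line v hv).space.starProjection.toLinearMap ∘ₗ (line t ht).space.subtype)
    (x := ⟨t, hmem⟩) ht
  refine h.trans ?_
  change ‖(line v hv).space.starProjection t‖ = _
  rw [starProjection_line, norm_smul, hv, mul_one, Real.norm_eq_abs]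

theorem projDet_line_left (T : Grass 1 H) {v : H} (hv : ‖v‖ = 1) :
    projDet (line v hv) T = ‖T.space.starProjection v‖ := by
  obtain ⟨t, ht, rfl, -⟩ := exists_eq_line T 0
  rw [projDet_line, starProjection_line, norm_smul, ht, mul_one, Real.norm_eq_abs, real_inner_comm]

theorem measurable_projDet_line {v : H} (hv : ‖v‖ = 1) :
    Measurable fun T : Grass 1 H => projDet (line v hv) T := by
  simp only [projDet_line_left]
  have h1 : Measurable fun T : Grass 1 H => T.space.starProjection := comap_measurable _
  have h2 : Measurable fun L : H →L[ℝ] H => ‖L v‖ :=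
    (ContinuousLinearMap.apply ℝ H v).continuous.norm.measurable
  exact h2.comp h1

variable [CompleteSpace H] [MeasurableSpace H] [BorelSpace H]
  (b : HilbertBasis (Option ℚ) ℝ H)

/-- The common direction of the increments, as a line. -/
noncomputable def axis : Grass 1 H := line (b none) (b.orthonormal.1 none)

theorem lintegral_encard_eq (κ : ℝ) (hκ : 0 ≤ κ) (V : Grass 1 H) {A : Set H}
    (hA : MeasurableSet A) (hAR : A ⊆ range (point b κ)) :
    ∫⁻ y : V.space, ((V.space.orthogonalProjectionOnto ⁻¹' {y} ∩ A).encard : ℝ≥0∞)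
        ∂μH[((1 : ℕ) : ℝ)] =
      ENNReal.ofReal (κ * projDet V (axis b)) * natMeasure b κ A := by
  obtain ⟨v, hv, rfl, hvu⟩ := exists_eq_line V (b none)
  rw [axis, projDet_line, abs_of_nonneg hvu, Nat.cast_one]
  let ψ : ℝ ≃ₗᵢ[ℝ] (line v hv).space := LinearIsometryEquiv.toSpanUnitSingleton v hv
  have hψ : ∀ y, ((ψ y : (line v hv).space) : H) = y • v := fun y => rfl
  have hψm := ψ.toIsometryEquiv.measurePreserving_hausdorffMeasure 1
  rw [← hψm.lintegral_comp_emb ψ.toIsometryEquiv.toHomeomorph.measurableEmbedding,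
    hausdorffMeasure_real, natMeasure, (measurableEmbedding_point b κ).map_apply,
    ← (lintegral_mult (mul_nonneg hκ hvu) (summable_coef b v)
      ((continuous_point b κ).measurable hA)).2]
  refine lintegral_congr fun y => ?_
  have himg : (line v hv).space.orthogonalProjectionOnto ⁻¹' {ψ y} ∩ A =
      point b κ '' {ω ∈ point b κ ⁻¹' A | treeSum (inc (κ * ⟪v, b none⟫_ℝ) (coef b v)) ω = y} := by
    have hiff : ∀ x, (line v hv).space.orthogonalProjectionOnto x = ψ y ↔ ⟪v, x⟫_ℝ = y := fun x => by
      rw [← Subtype.coe_inj, hψ]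
      change (line v hv).space.starProjection x = _ ↔ _
      rw [starProjection_line]
      exact (smul_left_injective ℝ (norm_ne_zero_iff.1 (by rw [hv]; exact one_ne_zero))).eq_iff
    ext x
    constructor
    · rintro ⟨hx, hxA⟩
      obtain ⟨ω, rfl⟩ := hAR hxA
      refine ⟨ω, ⟨hxA, ?_⟩, rfl⟩
      rw [← inner_point]
      exact (hiff _).1 hx
    · rintro ⟨ω, ⟨hω, h⟩, rfl⟩
      rw [← inner_point] at h
      exact ⟨(hiff _).2 h, hω⟩
  change ((((line v hv).space.orthogonalProjectionOnto ⁻¹' {ψ y} ∩ A).encard : ℕ∞) : ℝ≥0∞) = _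
  rw [himg, (point_injective b κ).encard_image, mult]

/-- With drift, the tangent field is constant: the private directions do not contribute. -/
theorem satisfiesProjectionFormula_point_one :
    SatisfiesProjectionFormula 1 (range (point b 1)) (natMeasure b 1) fun _ => axis b where
  sigmaFinite := inferInstance
  measure_compl := natMeasure_compl_range b 1
  measurable := measurable_const
  formula V A hA hAR := by
    rw [lintegral_encard_eq b 1 zero_le_one V hA hAR, setLIntegral_const, one_mul]

/-- Without drift, all projections are null, and the measure in the projection formula is zero. This
choice is forced by `measure_eq_zero_of_satisfiesProjectionFormula`. -/
theorem satisfiesProjectionFormula_point_zero :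
    SatisfiesProjectionFormula 1 (range (point b 0)) 0 fun _ => axis b where
  sigmaFinite := inferInstance
  measure_compl := rfl
  measurable := measurable_const
  formula V A hA hAR := by
    rw [lintegral_encard_eq b 0 le_rfl V hA hAR, zero_mul, ENNReal.ofReal_zero, zero_mul,
      Measure.restrict_zero, lintegral_zero_measure]

/-- Since all projections are null and no line is orthogonal to a whole Hilbert basis, zero is the
only measure that satisfies a projection formula. -/
theorem measure_eq_zero_of_satisfiesProjectionFormula {μ : Measure H} {T : H → Grass 1 H}
    (h : SatisfiesProjectionFormula 1 (range (point b 0)) μ T) : μ = 0 := by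
  have hR : MeasurableSet (range (point b 0)) :=
    (isClosedEmbedding_point b 0).isClosed_range.measurableSet
  have hb : ∀ i, ‖b i‖ = 1 := b.orthonormal.1
  have hae : ∀ i, ∀ᵐ x ∂μ.restrict (range (point b 0)),
      (T x).space.starProjection (b i) = 0 := fun i => by
    have hm : Measurable fun x => ENNReal.ofReal (projDet (line (b i) (hb i)) (T x)) :=
      ((measurable_projDet_line (hb i)).comp h.measurable).ennreal_ofReal
    have hf := h.formula (line (b i) (hb i)) _ hR Subset.rfl
    rw [lintegral_encard_eq b 0 le_rfl _ hR Subset.rfl, zero_mul, ENNReal.ofReal_zero, zero_mul,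
      eq_comm, lintegral_eq_zero_iff hm] at hf
    filter_upwards [hf] with x hx
    rw [Pi.zero_apply, ENNReal.ofReal_eq_zero, projDet_line_left] at hx
    exact norm_le_zero_iff.1 hx
  have hfalse : ∀ᵐ x ∂μ.restrict (range (point b 0)), False := by
    filter_upwards [ae_all_iff.2 hae] with x hx
    obtain ⟨t, ht, hT, -⟩ := exists_eq_line (T x) 0
    rw [hT] at hx
    have ht0 : t ≠ 0 := norm_ne_zero_iff.1 (by rw [ht]; exact one_ne_zero)
    have hz : ∀ i, ⟪b i, t⟫_ℝ = 0 := fun i => by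
      have := hx i
      rw [starProjection_line, smul_eq_zero_iff_left ht0] at this
      rw [real_inner_comm, this]
    refine ht0 (b.repr.injective ?_)
    ext i
    rw [b.repr_apply_apply, hz, map_zero]
    rfl
  rw [ae_iff] at hfalse
  simp only [not_false_eq_true, ofPred_true, Measure.restrict_apply_univ] at hfalse
  rw [← Measure.measure_univ_eq_zero, ← union_compl_self (range (point b 0))]
  exact measure_union_null hfalse h.measure_compl

theorem absolutelyContinuous_natMeasure (κ : ℝ) :
    natMeasure b κ ≪ (μH[1] : Measure H).restrict (range (point b κ)) ∧
      (μH[1] : Measure H).restrict (range (point b κ)) ≪ natMeasure b κ := by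
  rw [hausdorffMeasure_restrict_range]
  refine ⟨Measure.absolutelyContinuous_smul fun h => ?_, Measure.smul_absolutelyContinuous⟩
  have := two_le_hausdorffMeasure_range b κ
  rw [h] at this
  simp at this

theorem natMeasure_ne (κ : ℝ) :
    natMeasure b κ ≠ (μH[1] : Measure H).restrict (range (point b κ)) := fun h => by
  have h1 := natMeasure_range b κ
  rw [h, Measure.restrict_apply_self] at h1
  have := two_le_hausdorffMeasure_range b κ
  rw [h1] at this
  exact absurd this (by norm_num)

theorem sigmaFinite_restrict_range (κ : ℝ) :
    SigmaFinite ((μH[1] : Measure H).restrict (range (point b κ))) := by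
  have : IsFiniteMeasure ((μH[1] : Measure H).restrict (range (point b κ))) :=
    ⟨by rw [Measure.restrict_apply_univ]; exact hausdorffMeasure_range_lt_top b κ⟩
  infer_instance

theorem isPseudorectifiable_point_one : IsPseudorectifiable 1 (range (point b 1)) := by
  refine ⟨(isClosedEmbedding_point b 1).isClosed_range.measurableSet, ?_, natMeasure b 1,
    fun _ => axis b, satisfiesProjectionFormula_point_one b, ?_⟩
  · rw [Nat.cast_one]
    exact sigmaFinite_restrict_range b 1
  · rw [Nat.cast_one]
    exact absolutelyContinuous_natMeasure b 1

theorem not_restrict_absolutelyContinuous_zero (κ : ℝ) :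
    ¬ (μH[1] : Measure H).restrict (range (point b κ)) ≪ 0 := fun h => by
  have h1 : (μH[1] : Measure H).restrict (range (point b κ)) (range (point b κ)) = 0 := h rfl
  rw [Measure.restrict_apply_self] at h1
  have := two_le_hausdorffMeasure_range b κ
  rw [h1] at this
  simp at this

theorem not_isPseudorectifiable_point_zero : ¬ IsPseudorectifiable 1 (range (point b 0)) := by
  rintro ⟨-, -, μ, T, h, -, hac⟩
  rw [Nat.cast_one, measure_eq_zero_of_satisfiesProjectionFormula b h] at hac
  exact not_restrict_absolutelyContinuous_zero b 0 hac

omit [MeasurableSpace H] [BorelSpace H] in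
/-- Deleting the drift is linear. -/
theorem exists_image_range_point : ∃ L : H →L[ℝ] H, range (point b 0) = L '' range (point b 1) := by
  set L : H →L[ℝ] H :=
    ContinuousLinearMap.id ℝ H - (innerSL ℝ (b none)).smulRight (b none) with hL
  refine ⟨L, ?_⟩
  have hi : ∀ w, L (incr b 1 w) = incr b 0 w := fun w => by
    have h1 : ‖b none‖ = 1 := b.orthonormal.1 none
    have h2 : ⟪b none, b (some (label w))⟫_ℝ = 0 := b.orthonormal.2 (by simp)
    simp [hL, incr, inner_add_right, inner_smul_right, h1, h2]
  rw [← range_comp]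
  congr 1
  funext ω
  rw [Function.comp_apply, point, point, map_treeSum L (norm_incr_le b 1)]
  simp only [hi]

end BinaryTree

theorem mainTheorem12 {H : Type*} [NormedAddCommGroup H] [InnerProductSpace ℝ H]
    [CompleteSpace H] [TopologicalSpace.SeparableSpace H] [MeasurableSpace H] [BorelSpace H]
    (hH : ¬ FiniteDimensional ℝ H) :
    ∃ (R₁ R₂ : Set H) (μ₁ μ₂ : Measure H) (T₁ T₂ : H → Grass 1 H),
      (SatisfiesProjectionFormula 1 R₁ μ₁ T₁ ∧ SatisfiesProjectionFormula 1 R₂ μ₂ T₂) ∧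
      ((μ₁ ≪ (μH[1] : Measure H).restrict R₁ ∧ (μH[1] : Measure H).restrict R₁ ≪ μ₁) ∧
        μ₁ ≠ (μH[1] : Measure H).restrict R₁ ∧
        IsPseudorectifiable 1 R₁ ∧ ¬ IsRectifiable 1 R₁) ∧
      ((μH[1] : Measure H) R₂ < ∞ ∧ ¬ (μH[1] : Measure H).restrict R₂ ≪ μ₂ ∧
        ¬ IsPseudorectifiable 1 R₂) ∧
      (IsSeparatedSimilarityLimitSet R₁ ∧ IsSeparatedSimilarityLimitSet R₂) ∧
      ∃ L : H →L[ℝ] H, R₂ = L '' R₁ := by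
  obtain ⟨b⟩ := BinaryTree.exists_hilbertBasis_option_rat hH
  exact ⟨range (BinaryTree.point b 1), range (BinaryTree.point b 0), BinaryTree.natMeasure b 1, 0,
    fun _ => BinaryTree.axis b, fun _ => BinaryTree.axis b,
    ⟨BinaryTree.satisfiesProjectionFormula_point_one b,
      BinaryTree.satisfiesProjectionFormula_point_zero b⟩,
    ⟨BinaryTree.absolutelyContinuous_natMeasure b 1, BinaryTree.natMeasure_ne b 1,
      BinaryTree.isPseudorectifiable_point_one b, BinaryTree.not_isRectifiable_range_point b 1⟩,
    ⟨BinaryTree.hausdorffMeasure_range_lt_top b 0,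
      BinaryTree.not_restrict_absolutelyContinuous_zero b 0,
      BinaryTree.not_isPseudorectifiable_point_zero b⟩,
    ⟨BinaryTree.isSeparatedSimilarityLimitSet_range_point b 1,
      BinaryTree.isSeparatedSimilarityLimitSet_range_point b 0⟩,
    BinaryTree.exists_image_range_point b⟩
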